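/- Let $\phi(u)=\sum_{n\ge0}c_nu^n$ be a power series with radius of convergence $0<R\le\infty$, with $c_n\ge 0$ for all $n\ge 0$, $\phi(0)\ne 0$, and $\phi$ not affine linear (that is, not of the form $a+bu$). Assume that there is a $\tau\in(0,R)$ with $\tau\phi'(\tau)=\phi(\tau)$. Let $p$ be the period of $\phi$, that is, the maximal $p$ such that all $n$ with $c_n\neq0$ lie in one residue class modulo $p$. Put $\rho=\tau/\phi(\tau)$. Then there is a unique function $y(z)$, analytic in a neighbourhood of $0$ (unique as a germ), with $y(0)=0$ and $y(z)=z\phi(y(z))$. Its power series at $0$ has radius of convergence $\rho>0$, and in the disc $|z|<\rho$ we have $|y(z)|<R$ and $y(z)=z\phi(y(z))$. The singularities $z$ of $y$ with $|z|\le\rho$ (points to no neighbourhood of which $y$ extends analytically from the disc $|z|<\rho$) are exactly the $p$ points $\rho\zeta$ with $\zeta^p=1$. Moreover, for some $\varepsilon>0$, $y$ extends analytically to $\{|z|<\rho\}\cup\{|z-\rho|<\varepsilon,\ z\notin[\rho,\infty)\}$, and as $z\to\rho$ with $z\notin[\rho,\infty)$ it has the asymptotic expansion $$y(z)\sim\sum_{j\ge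 0}(-1)^jd_j\Bigl(1-\frac z\rho\Bigr)^{j/2}$$ (principal branch), i.e. for every $N\ge 0$, $$y(z)=\sum_{j=0}^{N-1}(-1)^jd_j\Bigl(1-\frac z\rho\Bigr)^{j/2}+O\Bigl(\Bigl|1-\frac z\rho\Bigr|^{N/2}\Bigr),$$ with real constants $d_j$, where $d_0=\tau$ and $d_1=\sqrt{2\phi(\tau)/\phi''(\tau)}$. The $d_j$ are computable in the following sense: $(d_j)_{j\ge0}$ is the unique real sequence with these values of $d_0,d_1$ for which $h(s)=\sum_{j\ge0}(-1)^jd_js^j$ satisfies $h(s)=\rho\,(1-s^2)\sum_{k\ge0}\frac{\phi^{(k)}(\tau)}{k!}(h(s)-\tau)^k$ as formal power series in $s$. Finally, $[z^n]y(z)=0$ for all $n\not\equiv 1\pmod p$. -/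

import Mathlib

open Filter Topology Asymptotics

noncomputable section

/-- The radius of convergence of a power series with real coefficients, in `[0, ∞]`. -/
def convRadius (φ : PowerSeries ℝ) : ENNReal :=
  (FormalMultilinearSeries.ofScalars ℝ (fun n => PowerSeries.coeff n φ)).radius

/-- The function `u ↦ ∑ₙ [uⁿ]φ · uⁿ` given by a real power series, of a real or a complex
variable. It is meaningful inside the disc of convergence. -/
def seriesFun {𝕜 : Type*} [RCLike 𝕜] (φ : PowerSeries ℝ) (u : 𝕜) : 𝕜 :=
  ∑' n : ℕ, ((PowerSeries.coeff n φ : ℝ) : 𝕜) * u ^ n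

/-- `φ(u) = u ^ r χ(u ^ p)` for some `r` and some power series `χ`: the exponents that occur
in `φ` all lie in one residue class modulo `p`. -/
def IsPeriodicWith (φ : PowerSeries ℝ) (p : ℕ) : Prop :=
  ∃ r : ℕ, ∀ n : ℕ, PowerSeries.coeff n φ ≠ 0 → n ≡ r [MOD p]

/-- `φ` is `p`-periodic and `p` is maximal with that property. -/
def HasPeriod (φ : PowerSeries ℝ) (p : ℕ) : Prop :=
  IsGreatest {q : ℕ | IsPeriodicWith φ q} p

/-- `w` is a singularity of the function `f` analytic on the domain `D`: a point of the closure
of `D` such that no function analytic at `w` agrees with `f` on `D` near `w`. -/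
def IsSingularityOn (f : ℂ → ℂ) (D : Set ℂ) (w : ℂ) : Prop :=
  w ∈ closure D ∧ ¬ ∃ g : ℂ → ℂ, AnalyticAt ℂ g w ∧ g =ᶠ[𝓝[D] w] f

/-- The plane without the ray `[ρ, ∞)`, on which the principal branch of `(1 - z / ρ) ^ (1 / 2)`
is analytic. -/
def slitAt (ρ : ℝ) : Set ℂ :=
  {z : ℂ | 1 - z / (ρ : ℂ) ∈ Complex.slitPlane}

/-- The formal series `h(s) = ∑ⱼ (-1) ^ j dⱼ s ^ j`. -/
def branchSeries (d : ℕ → ℝ) : PowerSeries ℝ :=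
  PowerSeries.mk (fun j => (-1) ^ j * d j)

/-- The coefficient identities of `h(s) = ρ (1 - s²) φ(h(s))`, where `φ` is expanded at `τ`
and `h(0) = τ`. Only the powers `(h - τ) ^ k` with `k ≤ n` contribute to the coefficient
of `s ^ n`. -/
def SatisfiesBranchEquation (φ : PowerSeries ℝ) (τ ρ : ℝ) (d : ℕ → ℝ) : Prop :=
  ∀ n : ℕ, PowerSeries.coeff n (branchSeries d) =
    PowerSeries.coeff n (PowerSeries.C ρ * (1 - PowerSeries.X ^ 2) *
      ∑ k ∈ Finset.range (n + 1),
        PowerSeries.C (iteratedDeriv k (seriesFun φ : ℝ → ℝ) τ / (k.factorial : ℝ)) *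
          (branchSeries d - PowerSeries.C τ) ^ k)

end

/-!
Write `M = φ(τ)`, so that `ρ M = τ` and `ρ φ'(τ) = 1`. Since the coefficients of `φ` are
nonnegative, `‖φ(u)‖ ≤ M` and `‖φ'(u)‖ ≤ φ'(τ)` on the disc `‖u‖ ≤ τ`. Hence, for `‖z‖ < ρ`, the map
`u ↦ z φ(u)` is a contraction of this disc, and its fixed point is `y(z)`
(`smallSolution`). On the circle `‖z‖ = ρ` the contraction constant is `1`, but it is not attained
(`norm_sub_lt`), so the fixed point is still unique; compactness gives its existence and the
continuity of `y` on the closed disc.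

The point `u = y(z)` solves `u / φ(u) = z`, so `y` continues analytically to a neighbourhood of `z`
as soon as `z φ'(u) ≠ 1`; where `z φ'(u) = 1`, differentiating the equation shows that no
continuation exists. Equality in the triangle inequality for `φ(u)` shows that `z φ'(u) = 1` happens
in the closed disc only at `z = ρ ζ` with `ζ ^ p = 1` (`mul_derivative_eq_one_iff`). The radius of
convergence is therefore `ρ`, and the symmetry `y(ζ z) = ζ y(z)` gives the vanishing coefficients.

Near `ρ`, Taylor expansion of `φ` at `τ` gives `1 - u / (ρ φ(u)) = S(u)²` with `S` analytic and with
a simple zero at `τ` (`exists_uniformizer`). The inverse function `H` of `S` solves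
`H(s) = ρ (1 - s²) φ(H(s))`, so `y(z)` is `H(s)` or `H(-s)` for `s = √(1 - z / ρ)`. The bound
`‖y(z)‖ < τ` selects `H(s)`, and this branch provides the continuation to a slit neighbourhood. The
asymptotic expansion is the Taylor expansion of `H`. Its coefficients satisfy the formal equation,
which has only one solution with prescribed first two coefficients (`IsFormalBranch.unique`); as
complex conjugation preserves the equation, they are real.
-/

noncomputable section

/-! ### Power series with real coefficients as functions -/

theorem exists_norm_coeff_mul_pow_le {φ : PowerSeries ℝ} {r : ℝ} (hr : 0 ≤ r)
    (hrR : ENNReal.ofReal r < convRadius φ) :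
    ∃ a ∈ Set.Ioo (0 : ℝ) 1, ∃ C > 0, ∀ n : ℕ, |PowerSeries.coeff n φ| * r ^ n ≤ C * a ^ n := by
  have h := (FormalMultilinearSeries.ofScalars ℝ
    (fun n => PowerSeries.coeff n φ)).norm_mul_pow_le_mul_pow_of_lt_radius (r := r.toNNReal) hrR
  simpa [Real.coe_toNNReal r hr] using h

theorem le_convRadius_of_summable {φ : PowerSeries ℝ} {r : ℝ} (hr : 0 ≤ r)
    (h : Summable fun n : ℕ => |PowerSeries.coeff n φ| * r ^ n) :
    ENNReal.ofReal r ≤ convRadius φ := by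
  refine FormalMultilinearSeries.le_radius_of_summable (r := r.toNNReal) _ ?_
  simpa [Real.coe_toNNReal r hr] using h

theorem summable_abs_coeff_mul_pow {φ : PowerSeries ℝ} {r : ℝ} (hr : 0 ≤ r)
    (hrR : ENNReal.ofReal r < convRadius φ) :
    Summable fun n : ℕ => |PowerSeries.coeff n φ| * r ^ n := by
  obtain ⟨a, ha, C, -, h⟩ := exists_norm_coeff_mul_pow_le hr hrR
  exact Summable.of_nonneg_of_le (fun n => by positivity) h
    ((summable_geometric_of_lt_one ha.1.le ha.2).mul_left C)

theorem exists_gt_lt_convRadius {φ : PowerSeries ℝ} {r : ℝ} (hr : 0 ≤ r)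
    (hrR : ENNReal.ofReal r < convRadius φ) :
    ∃ s : ℝ, r < s ∧ ENNReal.ofReal s < convRadius φ := by
  obtain ⟨s, hs1, hs2⟩ := ENNReal.lt_iff_exists_nnreal_btwn.1 hrR
  refine ⟨s, ?_, by simpa using hs2⟩
  have := (ENNReal.toReal_lt_toReal ENNReal.ofReal_ne_top ENNReal.coe_ne_top).2 hs1
  rwa [ENNReal.toReal_ofReal hr] at this

/-- Differentiation does not decrease the radius of convergence. (It does not change it, but only
this inequality is needed.) -/
theorem convRadius_le_derivative (φ : PowerSeries ℝ) :
    convRadius φ ≤ convRadius (PowerSeries.derivative ℝ φ) := by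
  refine ENNReal.le_of_forall_nnreal_lt fun r hr => ?_
  rcases eq_or_lt_of_le (show 0 ≤ r from zero_le) with rfl | hr0
  · simp
  have hr0' : (0 : ℝ) < r := by exact_mod_cast hr0
  have hr' : ENNReal.ofReal (r : ℝ) < convRadius φ := by simpa using hr
  obtain ⟨a, ha, C, hC, h⟩ := exists_norm_coeff_mul_pow_le hr0'.le hr'
  have key : Summable fun n : ℕ =>
      |PowerSeries.coeff n (PowerSeries.derivative ℝ φ)| * (r : ℝ) ^ n := by
    have hs : Summable fun n : ℕ => (n : ℝ) ^ 1 * a ^ n :=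
      summable_pow_mul_geometric_of_norm_lt_one 1 (by rw [Real.norm_of_nonneg ha.1.le]; exact ha.2)
    have hs' := ((summable_nat_add_iff 1).2 hs).mul_left (C / r)
    refine Summable.of_nonneg_of_le (fun n => by positivity) (fun n => ?_) hs'
    rw [PowerSeries.coeff_derivative, abs_mul]
    have := h (n + 1)
    have h1 : |PowerSeries.coeff (n + 1) φ| * (r : ℝ) ^ n ≤ C * a ^ (n + 1) / r := by
      rw [le_div_iff₀ hr0']; calc _ = _ := by ring
        _ ≤ _ := this
    have h2 : |(n : ℝ) + 1| = n + 1 := abs_of_nonneg (by positivity)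
    rw [h2]
    calc |PowerSeries.coeff (n + 1) φ| * ((n : ℝ) + 1) * (r : ℝ) ^ n
        = (n + 1) * (|PowerSeries.coeff (n + 1) φ| * (r : ℝ) ^ n) := by ring
      _ ≤ (n + 1) * (C * a ^ (n + 1) / r) := by gcongr
      _ = _ := by push_cast; ring
  simpa using le_convRadius_of_summable hr0'.le key

section RCLike

variable {𝕜 : Type*} [RCLike 𝕜]

theorem summable_seriesFun {φ : PowerSeries ℝ} {u : 𝕜}
    (hu : ENNReal.ofReal ‖u‖ < convRadius φ) :
    Summable fun n : ℕ => ((PowerSeries.coeff n φ : ℝ) : 𝕜) * u ^ n := by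
  refine Summable.of_norm ?_
  simpa [norm_mul, norm_pow] using summable_abs_coeff_mul_pow (norm_nonneg u) hu

theorem hasDerivAt_seriesFun {φ : PowerSeries ℝ} {u : 𝕜}
    (hu : ENNReal.ofReal ‖u‖ < convRadius φ) :
    HasDerivAt (seriesFun φ : 𝕜 → 𝕜) (seriesFun (PowerSeries.derivative ℝ φ) u) u := by
  obtain ⟨s, hus, hs⟩ := exists_gt_lt_convRadius (norm_nonneg u) hu
  have hs0 : 0 < s := (norm_nonneg u).trans_lt hus
  have hsum := summable_abs_coeff_mul_pow hs0.le (hs.trans_le (convRadius_le_derivative φ))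
  have hsum' : Summable fun n : ℕ => |PowerSeries.coeff n φ| * ((n : ℝ) * s ^ (n - 1)) := by
    rw [← summable_nat_add_iff 1]
    refine hsum.congr fun n => ?_
    rw [PowerSeries.coeff_derivative, abs_mul, abs_of_nonneg (by positivity : (0 : ℝ) ≤ n + 1)]
    simp only [Nat.add_sub_cancel]
    push_cast
    ring
  -- Termwise differentiation on the ball of a radius `s` strictly between `‖u‖` and the radius of
  -- convergence.
  have hd := hasDerivAt_tsum_of_isPreconnected (𝕜 := 𝕜) (t := Metric.ball (0 : 𝕜) s)
    (g := fun (n : ℕ) (v : 𝕜) => ((PowerSeries.coeff n φ : ℝ) : 𝕜) * v ^ n)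
    (g' := fun (n : ℕ) (v : 𝕜) => ((PowerSeries.coeff n φ : ℝ) : 𝕜) * ((n : 𝕜) * v ^ (n - 1)))
    hsum' Metric.isOpen_ball (Metric.isConnected_ball hs0).isPreconnected
    (fun n v _ => (hasDerivAt_pow n v).const_mul _)
    (fun n v hv => by
      have hv' : ‖v‖ ≤ s := (mem_ball_zero_iff.1 hv).le
      simp only [norm_mul, norm_pow, RCLike.norm_ofReal, RCLike.norm_natCast]
      gcongr)
    (mem_ball_zero_iff.2 hus) (summable_seriesFun hu) (mem_ball_zero_iff.2 hus)
  suffices key : (seriesFun (PowerSeries.derivative ℝ φ) u : 𝕜) = ∑' n : ℕ,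
      ((PowerSeries.coeff n φ : ℝ) : 𝕜) * ((n : 𝕜) * u ^ (n - 1)) by
    rw [key]
    exact hd
  unfold seriesFun
  rw [tsum_eq_zero_add' (f := fun n : ℕ =>
    ((PowerSeries.coeff n φ : ℝ) : 𝕜) * ((n : 𝕜) * u ^ (n - 1)))]
  · simp only [PowerSeries.coeff_derivative, Nat.cast_zero, zero_mul, mul_zero, zero_add,
      Nat.add_sub_cancel]
    refine tsum_congr fun n => ?_
    push_cast
    ring
  · have := summable_seriesFun (hu.trans_le (convRadius_le_derivative φ))
    refine this.congr fun n => ?_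
    rw [PowerSeries.coeff_derivative]
    simp only [Nat.add_sub_cancel]
    push_cast
    ring

theorem isOpen_norm_lt_convRadius (φ : PowerSeries ℝ) :
    IsOpen {u : 𝕜 | ENNReal.ofReal ‖u‖ < convRadius φ} :=
  isOpen_lt (ENNReal.continuous_ofReal.comp continuous_norm) continuous_const

theorem convRadius_le_iterate_derivative (φ : PowerSeries ℝ) (k : ℕ) :
    convRadius φ ≤ convRadius ((PowerSeries.derivative ℝ)^[k] φ) := by
  induction k with
  | zero => exact le_rfl
  | succ k ih =>
    rw [Function.iterate_succ_apply']
    exact ih.trans (convRadius_le_derivative _)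

theorem iteratedDeriv_seriesFun {φ : PowerSeries ℝ} (k : ℕ) {u : 𝕜}
    (hu : ENNReal.ofReal ‖u‖ < convRadius φ) :
    iteratedDeriv k (seriesFun φ : 𝕜 → 𝕜) u =
      seriesFun ((PowerSeries.derivative ℝ)^[k] φ) u := by
  induction k generalizing u with
  | zero => simp
  | succ k ih =>
    rw [iteratedDeriv_succ, Function.iterate_succ_apply']
    have : iteratedDeriv k (seriesFun φ : 𝕜 → 𝕜) =ᶠ[𝓝 u]
        seriesFun ((PowerSeries.derivative ℝ)^[k] φ) := by
      filter_upwards [(isOpen_norm_lt_convRadius φ).mem_nhds hu] with v hv using ih hv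
    rw [this.deriv_eq]
    exact (hasDerivAt_seriesFun (hu.trans_le (convRadius_le_iterate_derivative φ k))).deriv

theorem seriesFun_ofReal (φ : PowerSeries ℝ) (x : ℝ) :
    seriesFun φ (x : ℂ) = ((seriesFun φ x : ℝ) : ℂ) := by
  simp only [seriesFun, Complex.ofReal_tsum]
  refine tsum_congr fun n => ?_
  simp

/-- Taylor coefficients at a real point do not depend on whether the series is regarded as a
function of a real or of a complex variable. -/
theorem iteratedDeriv_seriesFun_ofReal {φ : PowerSeries ℝ} (k : ℕ) {x : ℝ}
    (hx : ENNReal.ofReal |x| < convRadius φ) :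
    iteratedDeriv k (seriesFun φ : ℂ → ℂ) (x : ℂ) =
      ((iteratedDeriv k (seriesFun φ : ℝ → ℝ) x : ℝ) : ℂ) := by
  rw [iteratedDeriv_seriesFun k (by simpa using hx), iteratedDeriv_seriesFun k (by simpa using hx),
    seriesFun_ofReal]

theorem analyticAt_seriesFun {φ : PowerSeries ℝ} {u : ℂ}
    (hu : ENNReal.ofReal ‖u‖ < convRadius φ) :
    AnalyticAt ℂ (seriesFun φ : ℂ → ℂ) u :=
  DifferentiableOn.analyticAt
    (fun v hv => (hasDerivAt_seriesFun (u := v) hv).differentiableAt.differentiableWithinAt)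
    ((isOpen_norm_lt_convRadius φ).mem_nhds hu)

end RCLike

/-- Triangle inequality for a series with nonnegative coefficients. -/
theorem norm_seriesFun_le {φ : PowerSeries ℝ} (hφ : ∀ n, 0 ≤ PowerSeries.coeff n φ) {u : ℂ} {t : ℝ}
    (hut : ‖u‖ ≤ t) (ht : ENNReal.ofReal t < convRadius φ) :
    ‖seriesFun φ u‖ ≤ seriesFun φ t := by
  have ht0 : 0 ≤ t := (norm_nonneg u).trans hut
  have hs : Summable fun n : ℕ => ((PowerSeries.coeff n φ : ℝ) : ℝ) * t ^ n :=
    summable_seriesFun (by simpa [abs_of_nonneg ht0] using ht)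
  refine tsum_of_norm_bounded hs.hasSum fun n => ?_
  simp only [norm_mul, norm_pow, RCLike.norm_ofReal, abs_of_nonneg (hφ n)]
  gcongr
  exact hφ n

theorem seriesFun_pos {φ : PowerSeries ℝ} (hφ : ∀ n, 0 ≤ PowerSeries.coeff n φ) {m : ℕ}
    (hm : PowerSeries.coeff m φ ≠ 0) {t : ℝ} (ht0 : 0 < t)
    (ht : ENNReal.ofReal t < convRadius φ) : 0 < seriesFun φ t := by
  have hs : Summable fun n : ℕ => ((PowerSeries.coeff n φ : ℝ) : ℝ) * t ^ n :=
    summable_seriesFun (by simpa [abs_of_nonneg ht0.le] using ht)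
  refine hs.tsum_pos (fun n => mul_nonneg (hφ n) (by positivity)) m ?_
  exact mul_pos (lt_of_le_of_ne (hφ m) hm.symm) (by positivity)

theorem seriesFun_lt_seriesFun {φ : PowerSeries ℝ} (hφ : ∀ n, 0 ≤ PowerSeries.coeff n φ) {m : ℕ}
    (hm0 : m ≠ 0) (hm : PowerSeries.coeff m φ ≠ 0) {s t : ℝ} (hs0 : 0 ≤ s) (hst : s < t)
    (ht : ENNReal.ofReal t < convRadius φ) : (seriesFun φ s : ℝ) < seriesFun φ t := by
  have hsum (x : ℝ) (hx0 : 0 ≤ x) (hx : x ≤ t) :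
      Summable fun n : ℕ => ((PowerSeries.coeff n φ : ℝ) : ℝ) * x ^ n :=
    summable_seriesFun (by
      rw [Real.norm_of_nonneg hx0]; exact (ENNReal.ofReal_le_ofReal hx).trans_lt ht)
  refine Summable.tsum_lt_tsum (i := m) (fun n => ?_) ?_ (hsum s hs0 hst.le)
    (hsum t (hs0.trans hst.le) le_rfl)
  · exact mul_le_mul_of_nonneg_left (pow_le_pow_left₀ hs0 hst.le n) (hφ n)
  · exact mul_lt_mul_of_pos_left (pow_lt_pow_left₀ hst hs0 hm0) (lt_of_le_of_ne (hφ m) hm.symm)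

theorem coeff_derivative_nonneg {φ : PowerSeries ℝ} (hφ : ∀ n, 0 ≤ PowerSeries.coeff n φ) (n : ℕ) :
    0 ≤ PowerSeries.coeff n (PowerSeries.derivative ℝ φ) := by
  rw [PowerSeries.coeff_derivative]
  exact mul_nonneg (hφ _) (by positivity)

theorem coeff_derivative_ne_zero {φ : PowerSeries ℝ} {n : ℕ}
    (h : PowerSeries.coeff (n + 1) φ ≠ 0) :
    PowerSeries.coeff n (PowerSeries.derivative ℝ φ) ≠ 0 := by
  rw [PowerSeries.coeff_derivative]
  exact mul_ne_zero h (by positivity)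

/-! ### The small solution of `u = z φ(u)` in the closed disc -/

/-- The standing hypotheses on `φ`, with the derivative at `τ` written as the value of the formal
derivative, and with the two equations for `τ` and `ρ` free of divisions. -/
structure SmoothInverseSchema (φ : PowerSeries ℝ) (τ ρ : ℝ) : Prop where
  nonneg : ∀ n, 0 ≤ PowerSeries.coeff n φ
  coeff_zero_ne : PowerSeries.coeff 0 φ ≠ 0
  exists_coeff_ne : ∃ m, 2 ≤ m ∧ PowerSeries.coeff m φ ≠ 0
  tau_pos : 0 < τ
  tau_lt : ENNReal.ofReal τ < convRadius φ
  characteristic : τ * seriesFun (PowerSeries.derivative ℝ φ) τ = seriesFun φ τ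
  rho_mul : ρ * seriesFun φ τ = τ

/-- The solution `u` of `u = z φ(u)` in the disc `‖u‖ ≤ τ`. It exists and is unique for `‖z‖ ≤ ρ`
(`smallSolution_spec`, `eq_smallSolution`); elsewhere the value is arbitrary and is not used. -/
def smallSolution (φ : PowerSeries ℝ) (τ : ℝ) (z : ℂ) : ℂ :=
  Classical.epsilon fun u : ℂ => ‖u‖ ≤ τ ∧ u = z * seriesFun φ u

/-- Equality in the triangle inequality for `φ(u)` forces the phases of all terms to agree
with that of the constant term. -/
theorem pow_eq_of_norm_seriesFun_eq {φ : PowerSeries ℝ} (hφ : ∀ n, 0 ≤ PowerSeries.coeff n φ)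
    (h0 : PowerSeries.coeff 0 φ ≠ 0) {t : ℝ} (ht0 : 0 ≤ t)
    (ht : ENNReal.ofReal t < convRadius φ) {u : ℂ} (hu : ‖u‖ = t)
    (heq : ‖seriesFun φ u‖ = seriesFun φ t) {n : ℕ} (hn : PowerSeries.coeff n φ ≠ 0) :
    u ^ n = (t : ℂ) ^ n := by
  have hsr : HasSum (fun n : ℕ => PowerSeries.coeff n φ * t ^ n) (seriesFun φ t) :=
    (summable_seriesFun (𝕜 := ℝ) (by simpa [abs_of_nonneg ht0] using ht)).hasSum
  have hsc : HasSum (fun n : ℕ => ((PowerSeries.coeff n φ : ℝ) : ℂ) * u ^ n) (seriesFun φ u) :=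
    (summable_seriesFun (𝕜 := ℂ) (by simpa [hu] using ht)).hasSum
  -- Rotate `φ(u)` to the positive axis and compare real parts term by term.
  obtain ⟨w, hw, hwu⟩ : ∃ w : ℂ, ‖w‖ = 1 ∧ w * seriesFun φ u = ‖seriesFun φ u‖ := by
    by_cases h : seriesFun φ u = 0
    · exact ⟨1, by simp, by simp [h]⟩
    · have h' : (‖seriesFun φ u‖ : ℂ) ≠ 0 := by simpa using h
      refine ⟨‖seriesFun φ u‖ / seriesFun φ u, ?_, by field_simp⟩
      rw [norm_div, Complex.norm_real, norm_norm, div_self (norm_ne_zero_iff.2 h)]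
  have hre : HasSum (fun n : ℕ => (w * (((PowerSeries.coeff n φ : ℝ) : ℂ) * u ^ n)).re)
      (seriesFun φ t) := by
    have := Complex.hasSum_re (hsc.mul_left w)
    rwa [hwu, Complex.ofReal_re, heq] at this
  have hle (n : ℕ) : 0 ≤ PowerSeries.coeff n φ * t ^ n -
      (w * (((PowerSeries.coeff n φ : ℝ) : ℂ) * u ^ n)).re := by
    refine sub_nonneg.2 ((Complex.re_le_norm _).trans ?_)
    simp [hw, hu, abs_of_nonneg (hφ n)]
  have hzero := (hasSum_zero_iff_of_nonneg hle).1 (by simpa using hsr.sub hre)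
  have hphase (n : ℕ) (hn : PowerSeries.coeff n φ ≠ 0) : w * u ^ n = (t : ℂ) ^ n := by
    have h1 := congrFun hzero n
    simp only [Pi.zero_apply] at h1
    have h2 : (w * u ^ n).re = t ^ n := by
      have : (w * (((PowerSeries.coeff n φ : ℝ) : ℂ) * u ^ n)).re =
          PowerSeries.coeff n φ * (w * u ^ n).re := by
        rw [← Complex.re_ofReal_mul]; congr 1; ring
      rw [this, ← mul_sub] at h1
      linarith [(mul_eq_zero.1 h1).resolve_left hn]
    have h3 : ‖w * u ^ n‖ = (w * u ^ n).re := by rw [h2]; simp [hw, hu]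
    have h4 : (w * u ^ n).im = 0 :=
      Complex.abs_re_eq_norm.1 (by rw [← h3, abs_of_nonneg (norm_nonneg _)])
    rw [← Complex.ofReal_pow, ← h2]
    exact Complex.ext (by simp) (by simpa using h4)
  have hw1 : w = 1 := by simpa using hphase 0 h0
  simpa [hw1] using hphase n hn

theorem IsPeriodicWith.dvd {φ : PowerSeries ℝ} {p : ℕ} (hp : IsPeriodicWith φ p)
    (h0 : PowerSeries.coeff 0 φ ≠ 0) {n : ℕ} (hn : PowerSeries.coeff n φ ≠ 0) : p ∣ n := by
  obtain ⟨r, hr⟩ := hp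
  exact (Nat.modEq_zero_iff_dvd.1 ((hr n hn).trans (hr 0 h0).symm))

theorem isPeriodicWith_of_dvd {φ : PowerSeries ℝ} {p : ℕ}
    (h : ∀ n, PowerSeries.coeff n φ ≠ 0 → p ∣ n) : IsPeriodicWith φ p :=
  ⟨0, fun n hn => Nat.modEq_zero_iff_dvd.2 (h n hn)⟩

/-- The least common multiple of two periods is a period, so the maximal period is a multiple of
every period. -/
theorem HasPeriod.dvd_of_isPeriodicWith {φ : PowerSeries ℝ} {p q : ℕ} (hp : HasPeriod φ p)
    (hp0 : p ≠ 0) (hq0 : q ≠ 0) (h0 : PowerSeries.coeff 0 φ ≠ 0) (hq : IsPeriodicWith φ q) :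
    q ∣ p := by
  have hl : IsPeriodicWith φ (Nat.lcm q p) :=
    isPeriodicWith_of_dvd fun n hn => Nat.lcm_dvd (hq.dvd h0 hn) (hp.1.dvd h0 hn)
  have h1 : Nat.lcm q p ≤ p := hp.2 hl
  have h2 : p ∣ Nat.lcm q p := Nat.dvd_lcm_right q p
  have h3 : Nat.lcm q p = p :=
    le_antisymm h1 (Nat.le_of_dvd (Nat.pos_of_ne_zero (Nat.lcm_ne_zero hq0 hp0)) h2)
  rw [← h3]
  exact Nat.dvd_lcm_left q p

/-- The inverse function theorem for one complex variable, in the form used below. -/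
theorem AnalyticAt.exists_local_inverse {f : ℂ → ℂ} {a : ℂ} (hf : AnalyticAt ℂ f a)
    (hf' : deriv f a ≠ 0) :
    ∃ g : ℂ → ℂ, AnalyticAt ℂ g (f a) ∧ g (f a) = a ∧ HasDerivAt g (deriv f a)⁻¹ (f a) ∧
      (∀ᶠ w in 𝓝 (f a), f (g w) = w) ∧ ∀ᶠ u in 𝓝 a, g (f u) = u :=
  ⟨hf.hasStrictDerivAt.localInverse _ _ _ hf', hf.analyticAt_localInverse hf',
    HasStrictFDerivAt.localInverse_apply_image ..,
    (hf.hasStrictDerivAt.to_localInverse hf').hasDerivAt,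
    HasStrictDerivAt.eventually_right_inverse .., HasStrictFDerivAt.eventually_left_inverse ..⟩

namespace SmoothInverseSchema

variable {φ : PowerSeries ℝ} {τ ρ : ℝ}

theorem seriesFun_tau_pos (h : SmoothInverseSchema φ τ ρ) : 0 < (seriesFun φ τ : ℝ) :=
  seriesFun_pos h.nonneg h.coeff_zero_ne h.tau_pos h.tau_lt

theorem rho_pos (h : SmoothInverseSchema φ τ ρ) : 0 < ρ :=
  pos_of_mul_pos_left (h.tau_pos.trans_eq h.rho_mul.symm) h.seriesFun_tau_pos.le

theorem rho_mul_derivative (h : SmoothInverseSchema φ τ ρ) :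
    ρ * seriesFun (PowerSeries.derivative ℝ φ) τ = 1 := by
  have h1 := h.characteristic
  have h2 := h.rho_mul
  have h3 := h.tau_pos.ne'
  apply mul_left_cancel₀ h3
  linear_combination ρ * h1 + h2

theorem tau_lt_derivative (h : SmoothInverseSchema φ τ ρ) :
    ENNReal.ofReal τ < convRadius (PowerSeries.derivative ℝ φ) :=
  h.tau_lt.trans_le (convRadius_le_derivative φ)

theorem norm_lt_convRadius (h : SmoothInverseSchema φ τ ρ) {u : ℂ} (hu : ‖u‖ ≤ τ) :
    ENNReal.ofReal ‖u‖ < convRadius φ :=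
  (ENNReal.ofReal_le_ofReal hu).trans_lt h.tau_lt

theorem norm_derivative_le (h : SmoothInverseSchema φ τ ρ) {u : ℂ} (hu : ‖u‖ ≤ τ) :
    ‖(seriesFun (PowerSeries.derivative ℝ φ) u : ℂ)‖ ≤
      seriesFun (PowerSeries.derivative ℝ φ) τ :=
  norm_seriesFun_le (coeff_derivative_nonneg h.nonneg) hu h.tau_lt_derivative

theorem derivative_lt_derivative (h : SmoothInverseSchema φ τ ρ) {t : ℝ} (ht0 : 0 ≤ t)
    (ht : t < τ) : (seriesFun (PowerSeries.derivative ℝ φ) t : ℝ) <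
      seriesFun (PowerSeries.derivative ℝ φ) τ := by
  obtain ⟨m, hm2, hm⟩ := h.exists_coeff_ne
  obtain ⟨k, rfl⟩ := Nat.exists_eq_add_of_le hm2
  refine seriesFun_lt_seriesFun (coeff_derivative_nonneg h.nonneg) (m := k + 1) (by omega)
    (coeff_derivative_ne_zero ?_) ht0 ht h.tau_lt_derivative
  rwa [show k + 1 + 1 = 2 + k by ring]

theorem norm_sub_le_of_norm_le (h : SmoothInverseSchema φ τ ρ) {t : ℝ} (ht : t ≤ τ) {u v : ℂ}
    (hu : ‖u‖ ≤ t) (hv : ‖v‖ ≤ t) :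
    ‖(seriesFun φ u : ℂ) - seriesFun φ v‖ ≤
      seriesFun (PowerSeries.derivative ℝ φ) t * ‖u - v‖ := by
  refine Convex.norm_image_sub_le_of_norm_hasDerivWithin_le (s := Metric.closedBall (0 : ℂ) t)
    (f := (seriesFun φ : ℂ → ℂ)) (f' := seriesFun (PowerSeries.derivative ℝ φ))
    (fun w hw => ?_) (fun w hw => ?_) (convex_closedBall _ _)
    (mem_closedBall_zero_iff.2 hv) (mem_closedBall_zero_iff.2 hu)
  · have := mem_closedBall_zero_iff.1 hw
    exact (hasDerivAt_seriesFun (h.norm_lt_convRadius (this.trans ht))).hasDerivWithinAt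
  · exact norm_seriesFun_le (coeff_derivative_nonneg h.nonneg) (mem_closedBall_zero_iff.1 hw)
      ((ENNReal.ofReal_le_ofReal ht).trans_lt h.tau_lt_derivative)

theorem norm_sub_le (h : SmoothInverseSchema φ τ ρ) {u v : ℂ} (hu : ‖u‖ ≤ τ) (hv : ‖v‖ ≤ τ) :
    ‖(seriesFun φ u : ℂ) - seriesFun φ v‖ ≤
      seriesFun (PowerSeries.derivative ℝ φ) τ * ‖u - v‖ :=
  h.norm_sub_le_of_norm_le le_rfl hu hv

/-- On the closed disc the Lipschitz constant `φ'(τ)` is not attained: the middle part of the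
segment from `u` to `v` lies in a smaller disc, where `φ'` is smaller. -/
theorem norm_sub_lt (h : SmoothInverseSchema φ τ ρ) {u v : ℂ} (hu : ‖u‖ ≤ τ) (hv : ‖v‖ ≤ τ)
    (huv : u ≠ v) :
    ‖(seriesFun φ u : ℂ) - seriesFun φ v‖ <
      seriesFun (PowerSeries.derivative ℝ φ) τ * ‖u - v‖ := by
  have hmid {a b : ℂ} (ha : ‖a‖ ≤ τ) (hb : ‖b‖ ≤ τ) (hab : a ≠ b) :
      ‖((1 / 2 : ℝ) : ℂ) * a + ((1 / 2 : ℝ) : ℂ) * b‖ < τ := by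
    have := (strictConvex_closedBall ℝ (0 : ℂ) τ) (mem_closedBall_zero_iff.2 ha)
      (mem_closedBall_zero_iff.2 hb) hab (a := 1 / 2) (b := 1 / 2) (by norm_num) (by norm_num)
      (by norm_num)
    rw [interior_closedBall _ h.tau_pos.ne', mem_ball_zero_iff] at this
    simpa using this
  -- `m` is the midpoint of `[u, v]` and `k` the midpoint of `[m, v]`; both lie in the open disc, so
  -- the Lipschitz constant is strictly better on `[m, k]`.
  set m : ℂ := ((1 / 2 : ℝ) : ℂ) * u + ((1 / 2 : ℝ) : ℂ) * v with hm
  have hmτ : ‖m‖ < τ := hmid hu hv huv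
  have hum : u - m = (1 / 2 : ℂ) * (u - v) := by rw [hm]; push_cast; ring
  have hmv : m - v = (1 / 2 : ℂ) * (u - v) := by rw [hm]; push_cast; ring
  have hmv' : m ≠ v := by
    rw [← sub_ne_zero, hmv]
    exact mul_ne_zero (by norm_num) (sub_ne_zero.2 huv)
  set k : ℂ := ((1 / 2 : ℝ) : ℂ) * m + ((1 / 2 : ℝ) : ℂ) * v with hk
  have hkτ : ‖k‖ < τ := hmid hmτ.le hv hmv'
  have hmk : m - k = (1 / 4 : ℂ) * (u - v) := by
    rw [hk]; push_cast; linear_combination (1 / 2 : ℂ) * hmv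
  have hkv : k - v = (1 / 4 : ℂ) * (u - v) := by
    rw [hk]; push_cast; linear_combination (1 / 2 : ℂ) * hmv
  set t := max ‖m‖ ‖k‖
  have htτ : t < τ := max_lt hmτ hkτ
  have h1 := h.norm_sub_le hu hmτ.le
  have h2 := h.norm_sub_le_of_norm_le htτ.le (le_max_left ‖m‖ ‖k‖) (le_max_right ‖m‖ ‖k‖)
  have h3 := h.norm_sub_le hkτ.le hv
  have h4 := h.derivative_lt_derivative ((norm_nonneg m).trans (le_max_left _ _)) htτ
  have hpos : 0 < ‖u - v‖ := norm_pos_iff.2 (sub_ne_zero.2 huv)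
  rw [hum, norm_mul] at h1
  rw [hmk, norm_mul] at h2
  rw [hkv, norm_mul] at h3
  norm_num at h1 h2 h3
  have h5 : ‖(seriesFun φ u : ℂ) - seriesFun φ v‖ ≤ ‖(seriesFun φ u : ℂ) - seriesFun φ m‖ +
      ‖(seriesFun φ m : ℂ) - seriesFun φ k‖ + ‖(seriesFun φ k : ℂ) - seriesFun φ v‖ :=
    (norm_sub_le_norm_sub_add_norm_sub _ (seriesFun φ k) _).trans
      (add_le_add_left (norm_sub_le_norm_sub_add_norm_sub _ (seriesFun φ m) _) _)
  have h6 := mul_lt_mul_of_pos_right h4 (mul_pos (by norm_num : (0 : ℝ) < 1 / 4) hpos)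
  linarith

theorem solution_unique (h : SmoothInverseSchema φ τ ρ) {z u v : ℂ} (hz : ‖z‖ ≤ ρ)
    (hu : ‖u‖ ≤ τ) (hv : ‖v‖ ≤ τ) (hzu : u = z * seriesFun φ u) (hzv : v = z * seriesFun φ v) :
    u = v := by
  by_contra huv
  have h1 := h.norm_sub_lt hu hv huv
  have h2 : ‖u - v‖ = ‖z‖ * ‖(seriesFun φ u : ℂ) - seriesFun φ v‖ := by
    rw [← norm_mul, mul_sub, ← hzu, ← hzv]
  have h3 : ‖z‖ * ‖(seriesFun φ u : ℂ) - seriesFun φ v‖ ≤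
      ρ * ‖(seriesFun φ u : ℂ) - seriesFun φ v‖ := by gcongr
  have h4 := mul_lt_mul_of_pos_left h1 h.rho_pos
  rw [← mul_assoc, h.rho_mul_derivative] at h4
  linarith

theorem norm_mul_le (h : SmoothInverseSchema φ τ ρ) {z u : ℂ} (hz : ‖z‖ ≤ ρ) (hu : ‖u‖ ≤ τ) :
    ‖z * seriesFun φ u‖ ≤ τ := by
  rw [norm_mul, ← h.rho_mul]
  exact mul_le_mul hz (norm_seriesFun_le h.nonneg hu h.tau_lt) (norm_nonneg _) h.rho_pos.le

theorem norm_lt_of_solution (h : SmoothInverseSchema φ τ ρ) {z u : ℂ} (hz : ‖z‖ < ρ)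
    (hu : ‖u‖ ≤ τ) (hzu : u = z * seriesFun φ u) : ‖u‖ < τ := by
  rw [hzu, norm_mul, ← h.rho_mul]
  exact mul_lt_mul_of_nonneg_of_pos hz (norm_seriesFun_le h.nonneg hu h.tau_lt) (norm_nonneg _)
    h.seriesFun_tau_pos

/-- The contraction principle on the disc `‖u‖ ≤ τ`, with constant `‖z‖ φ'(τ) < 1`. -/
theorem exists_solution_of_norm_lt (h : SmoothInverseSchema φ τ ρ) {z : ℂ} (hz : ‖z‖ < ρ) :
    ∃ u : ℂ, ‖u‖ ≤ τ ∧ u = z * seriesFun φ u := by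
  have hmaps : Set.MapsTo (fun u : ℂ => z * seriesFun φ u) (Metric.closedBall 0 τ)
      (Metric.closedBall 0 τ) := fun u hu => mem_closedBall_zero_iff.2
    (h.norm_mul_le hz.le (mem_closedBall_zero_iff.1 hu))
  have hd0 : 0 ≤ (seriesFun (PowerSeries.derivative ℝ φ) τ : ℝ) :=
    (norm_nonneg _).trans (h.norm_derivative_le (u := 0) (by simpa using h.tau_pos.le))
  have hdpos : 0 < (seriesFun (PowerSeries.derivative ℝ φ) τ : ℝ) := by
    refine lt_of_le_of_ne hd0 fun h0 => ?_
    have := h.rho_mul_derivative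
    rw [← h0] at this
    simp at this
  let K : NNReal := ⟨‖z‖ * seriesFun (PowerSeries.derivative ℝ φ) τ,
    mul_nonneg (norm_nonneg _) hd0⟩
  have hK : K < 1 := by
    rw [← NNReal.coe_lt_coe, NNReal.coe_one, ← h.rho_mul_derivative]
    exact mul_lt_mul_of_pos_right hz hdpos
  have hc : ContractingWith K (hmaps.restrict _ _ _) := by
    refine ⟨hK, LipschitzWith.of_dist_le_mul fun a b => ?_⟩
    rw [Subtype.dist_eq, Subtype.dist_eq, dist_eq_norm, dist_eq_norm]
    change ‖z * seriesFun φ (a : ℂ) - z * seriesFun φ (b : ℂ)‖ ≤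
      (‖z‖ * seriesFun (PowerSeries.derivative ℝ φ) τ) * _
    rw [← mul_sub, norm_mul, mul_assoc]
    exact mul_le_mul_of_nonneg_left (h.norm_sub_le (mem_closedBall_zero_iff.1 a.2)
      (mem_closedBall_zero_iff.1 b.2)) (norm_nonneg _)
  obtain ⟨u, hu, hfix, -⟩ := hc.exists_fixedPoint' Metric.isClosed_closedBall.isComplete hmaps
    (Metric.mem_closedBall_self h.tau_pos.le) (edist_ne_top _ _)
  exact ⟨u, mem_closedBall_zero_iff.1 hu, hfix.symm⟩

theorem continuousAt_seriesFun (h : SmoothInverseSchema φ τ ρ) {u : ℂ} (hu : ‖u‖ ≤ τ) :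
    ContinuousAt (seriesFun φ : ℂ → ℂ) u :=
  (hasDerivAt_seriesFun (h.norm_lt_convRadius hu)).continuousAt

/-- The equation `u = z φ(u)` passes to cluster points. -/
theorem solution_of_mapClusterPt (h : SmoothInverseSchema φ τ ρ) {l : Filter ℂ} {z₀ x : ℂ}
    (hl : l ≤ 𝓝 z₀) {y : ℂ → ℂ} (hy : ∀ᶠ z in l, y z = z * seriesFun φ (y z)) (hx : ‖x‖ ≤ τ)
    (hcl : MapClusterPt x l y) : x = z₀ * seriesFun φ x := by
  obtain ⟨U, hU, hUx⟩ := mapClusterPt_iff_ultrafilter.1 hcl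
  have h1 : Tendsto (fun z => z * seriesFun φ (y z)) U (𝓝 (z₀ * seriesFun φ x)) :=
    Tendsto.mul (hU.trans hl) ((h.continuousAt_seriesFun hx).tendsto.comp hUx)
  exact tendsto_nhds_unique (hUx.congr' (hU hy)) h1

/-- On the boundary circle a solution is obtained as a cluster point of solutions in the disc. -/
theorem exists_solution (h : SmoothInverseSchema φ τ ρ) {z : ℂ} (hz : ‖z‖ ≤ ρ) :
    ∃ u : ℂ, ‖u‖ ≤ τ ∧ u = z * seriesFun φ u := by
  choose! y hy using fun (w : ℂ) (hw : ‖w‖ < ρ) => h.exists_solution_of_norm_lt hw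
  have hne : (𝓝[Metric.ball 0 ρ] z).NeBot := by
    rw [← mem_closure_iff_nhdsWithin_neBot, closure_ball _ h.rho_pos.ne']
    exact mem_closedBall_zero_iff.2 hz
  have hev : ∀ᶠ w in 𝓝[Metric.ball 0 ρ] z, ‖y w‖ ≤ τ ∧ y w = w * seriesFun φ (y w) := by
    filter_upwards [self_mem_nhdsWithin] with w hw using hy w (mem_ball_zero_iff.1 hw)
  obtain ⟨x, hx, hcl⟩ := (isCompact_closedBall (0 : ℂ) τ).exists_mapClusterPt
    (u := y) (f := 𝓝[Metric.ball 0 ρ] z)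
    (tendsto_principal.2 (hev.mono fun w hw => mem_closedBall_zero_iff.2 hw.1))
  rw [mem_closedBall_zero_iff] at hx
  exact ⟨x, hx, h.solution_of_mapClusterPt nhdsWithin_le_nhds (hev.mono fun w hw => hw.2) hx hcl⟩

theorem smallSolution_spec (h : SmoothInverseSchema φ τ ρ) {z : ℂ} (hz : ‖z‖ ≤ ρ) :
    ‖smallSolution φ τ z‖ ≤ τ ∧
      smallSolution φ τ z = z * seriesFun φ (smallSolution φ τ z) :=
  Classical.epsilon_spec (h.exists_solution hz)

theorem eq_smallSolution (h : SmoothInverseSchema φ τ ρ) {z u : ℂ} (hz : ‖z‖ ≤ ρ)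
    (hu : ‖u‖ ≤ τ) (hzu : u = z * seriesFun φ u) : u = smallSolution φ τ z :=
  h.solution_unique hz hu (h.smallSolution_spec hz).1 hzu (h.smallSolution_spec hz).2

theorem norm_smallSolution_lt (h : SmoothInverseSchema φ τ ρ) {z : ℂ} (hz : ‖z‖ < ρ) :
    ‖smallSolution φ τ z‖ < τ :=
  h.norm_lt_of_solution hz (h.smallSolution_spec hz.le).1 (h.smallSolution_spec hz.le).2

theorem smallSolution_zero (h : SmoothInverseSchema φ τ ρ) : smallSolution φ τ 0 = 0 :=
  (h.eq_smallSolution (by simpa using h.rho_pos.le) (by simpa using h.tau_pos.le) (by simp)).symm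

theorem smallSolution_rho (h : SmoothInverseSchema φ τ ρ) : smallSolution φ τ ρ = τ := by
  refine (h.eq_smallSolution ?_ ?_ ?_).symm
  · simp [abs_of_pos h.rho_pos]
  · simp [abs_of_pos h.tau_pos]
  · rw [seriesFun_ofReal]
    exact_mod_cast h.rho_mul.symm

/-- By uniqueness, every cluster point of `y` at `z` is `y(z)`, and the range is bounded. -/
theorem continuousOn_smallSolution (h : SmoothInverseSchema φ τ ρ) :
    ContinuousOn (smallSolution φ τ) (Metric.closedBall 0 ρ) := by
  intro z hz
  rw [mem_closedBall_zero_iff] at hz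
  have hev : ∀ᶠ w in 𝓝[Metric.closedBall 0 ρ] z, ‖smallSolution φ τ w‖ ≤ τ ∧
      smallSolution φ τ w = w * seriesFun φ (smallSolution φ τ w) := by
    filter_upwards [self_mem_nhdsWithin] with w hw
      using h.smallSolution_spec (mem_closedBall_zero_iff.1 hw)
  refine (isCompact_closedBall (0 : ℂ) τ).tendsto_nhds_of_unique_mapClusterPt
    (hev.mono fun w hw => mem_closedBall_zero_iff.2 hw.1) fun x hx hcl => ?_
  rw [mem_closedBall_zero_iff] at hx
  exact h.eq_smallSolution hz hx
    (h.solution_of_mapClusterPt nhdsWithin_le_nhds (hev.mono fun w hw => hw.2) hx hcl)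

theorem seriesFun_ne_zero_of_solution (h : SmoothInverseSchema φ τ ρ) {z u : ℂ}
    (hzu : u = z * seriesFun φ u) : (seriesFun φ u : ℂ) ≠ 0 := by
  intro h0
  have hu : u = 0 := by rw [hzu, h0, mul_zero]
  rw [hu] at h0
  have : (seriesFun φ (0 : ℂ) : ℂ) = ((PowerSeries.coeff 0 φ : ℝ) : ℂ) := by
    unfold seriesFun
    rw [tsum_eq_single 0 (fun n hn => by simp [hn])]
    simp
  rw [this] at h0
  exact h.coeff_zero_ne (by exact_mod_cast h0)

/-- Where `z φ'(u) ≠ 1`, the function `u / φ(u)` has an analytic local inverse. -/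
theorem exists_local_solution (h : SmoothInverseSchema φ τ ρ) {z₀ u₀ : ℂ} (hu : ‖u₀‖ ≤ τ)
    (hzu : u₀ = z₀ * seriesFun φ u₀)
    (hd : z₀ * seriesFun (PowerSeries.derivative ℝ φ) u₀ ≠ 1) :
    ∃ g : ℂ → ℂ, AnalyticAt ℂ g z₀ ∧
      ∀ᶠ u in 𝓝 u₀, ∀ z, u = z * seriesFun φ u → g z = u := by
  have hne := h.seriesFun_ne_zero_of_solution hzu
  have hD := hasDerivAt_seriesFun (h.norm_lt_convRadius hu)
  have hF : AnalyticAt ℂ (fun u : ℂ => u / seriesFun φ u) u₀ :=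
    analyticAt_id.div (analyticAt_seriesFun (h.norm_lt_convRadius hu)) hne
  have hF' : deriv (fun u : ℂ => u / seriesFun φ u) u₀ ≠ 0 := by
    rw [((hasDerivAt_id' u₀).fun_div hD hne).deriv]
    refine div_ne_zero ?_ (pow_ne_zero 2 hne)
    have : 1 * seriesFun φ u₀ - u₀ * seriesFun (PowerSeries.derivative ℝ φ) u₀ =
        seriesFun φ u₀ * (1 - z₀ * seriesFun (PowerSeries.derivative ℝ φ) u₀) := by
      linear_combination (-seriesFun (PowerSeries.derivative ℝ φ) u₀) * hzu
    rw [this]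
    exact mul_ne_zero hne (sub_ne_zero.2 hd.symm)
  have hF0 : u₀ / seriesFun φ u₀ = z₀ := by rw [div_eq_iff hne]; exact hzu
  obtain ⟨g, hg, -, -, -, hinv⟩ := hF.exists_local_inverse hF'
  rw [hF0] at hg
  refine ⟨g, hg, ?_⟩
  filter_upwards [hinv, (h.continuousAt_seriesFun hu).eventually_ne hne] with u h1 h2 z h3
  rw [← h1]
  congr 1
  rw [eq_div_iff h2]
  exact h3.symm

theorem exists_analyticAt_eventuallyEq (h : SmoothInverseSchema φ τ ρ) {z₀ : ℂ} (hz : ‖z₀‖ ≤ ρ)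
    (hd : z₀ * seriesFun (PowerSeries.derivative ℝ φ) (smallSolution φ τ z₀) ≠ 1) :
    ∃ g : ℂ → ℂ, AnalyticAt ℂ g z₀ ∧
      g =ᶠ[𝓝[Metric.closedBall 0 ρ] z₀] smallSolution φ τ := by
  obtain ⟨hu, hzu⟩ := h.smallSolution_spec hz
  obtain ⟨g, hg, hgu⟩ := h.exists_local_solution hu hzu hd
  refine ⟨g, hg, ?_⟩
  filter_upwards [(h.continuousOn_smallSolution z₀ (mem_closedBall_zero_iff.2 hz)).eventually hgu,
    self_mem_nhdsWithin] with z h1 h2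
  exact h1 z (h.smallSolution_spec (mem_closedBall_zero_iff.1 h2)).2

theorem norm_mul_derivative_lt_of_norm_lt (h : SmoothInverseSchema φ τ ρ) {z u : ℂ}
    (hz : ‖z‖ ≤ ρ) (hu : ‖u‖ < τ) :
    ‖z * seriesFun (PowerSeries.derivative ℝ φ) u‖ < 1 := by
  rw [norm_mul, ← h.rho_mul_derivative]
  have h1 : ‖(seriesFun (PowerSeries.derivative ℝ φ) u : ℂ)‖ ≤
      seriesFun (PowerSeries.derivative ℝ φ) ‖u‖ :=
    norm_seriesFun_le (coeff_derivative_nonneg h.nonneg) le_rfl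
      ((ENNReal.ofReal_le_ofReal hu.le).trans_lt h.tau_lt_derivative)
  have h2 := h.derivative_lt_derivative (norm_nonneg u) hu
  exact mul_lt_mul' hz (h1.trans_lt h2) (norm_nonneg _) h.rho_pos

theorem analyticAt_smallSolution (h : SmoothInverseSchema φ τ ρ) {z : ℂ} (hz : ‖z‖ < ρ) :
    AnalyticAt ℂ (smallSolution φ τ) z := by
  have hd : z * seriesFun (PowerSeries.derivative ℝ φ) (smallSolution φ τ z) ≠ 1 := by
    intro h1
    have := h.norm_mul_derivative_lt_of_norm_lt hz.le (h.norm_smallSolution_lt hz)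
    rw [h1, norm_one] at this
    exact lt_irrefl _ this
  obtain ⟨g, hg, heq⟩ := h.exists_analyticAt_eventuallyEq hz.le hd
  rw [nhdsWithin_eq_nhds.2 (Metric.closedBall_mem_nhds_of_mem (by simpa using hz))] at heq
  exact hg.congr heq

/-- The period `0` would mean that only one coefficient of `φ` is nonzero. -/
theorem period_ne_zero (h : SmoothInverseSchema φ τ ρ) {p : ℕ} (hp : HasPeriod φ p) : p ≠ 0 := by
  rintro rfl
  obtain ⟨m, hm2, hm⟩ := h.exists_coeff_ne
  have := hp.1.dvd h.coeff_zero_ne hm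
  rw [zero_dvd_iff] at this
  omega

theorem seriesFun_mul_of_pow_eq_one (h : SmoothInverseSchema φ τ ρ) {p : ℕ} (hp : HasPeriod φ p)
    {ζ : ℂ} (hζ : ζ ^ p = 1) (u : ℂ) : seriesFun φ (ζ * u) = seriesFun φ u := by
  refine tsum_congr fun n => ?_
  by_cases hn : PowerSeries.coeff n φ = 0
  · simp [hn]
  · obtain ⟨k, rfl⟩ := hp.1.dvd h.coeff_zero_ne hn
    rw [mul_pow, pow_mul, hζ, one_pow, one_mul]

theorem derivative_mul_of_pow_eq_one (h : SmoothInverseSchema φ τ ρ) {p : ℕ} (hp : HasPeriod φ p)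
    {ζ : ℂ} (hζ : ζ ^ p = 1) (u : ℂ) :
    ζ * seriesFun (PowerSeries.derivative ℝ φ) (ζ * u) =
      seriesFun (PowerSeries.derivative ℝ φ) u := by
  unfold seriesFun
  rw [← tsum_mul_left]
  refine tsum_congr fun n => ?_
  by_cases hn : PowerSeries.coeff (n + 1) φ = 0
  · simp [hn, PowerSeries.coeff_derivative]
  · obtain ⟨k, hk⟩ := hp.1.dvd h.coeff_zero_ne hn
    have : ζ * ζ ^ n = 1 := by rw [← pow_succ', hk, pow_mul, hζ, one_pow]
    rw [mul_pow]
    linear_combination (((PowerSeries.coeff n (PowerSeries.derivative ℝ φ) : ℝ) : ℂ) * u ^ n) * this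

theorem smallSolution_mul_of_pow_eq_one (h : SmoothInverseSchema φ τ ρ) {p : ℕ}
    (hp : HasPeriod φ p) {ζ : ℂ} (hζ : ζ ^ p = 1) {z : ℂ} (hz : ‖z‖ ≤ ρ) :
    smallSolution φ τ (ζ * z) = ζ * smallSolution φ τ z := by
  have hζ1 : ‖ζ‖ = 1 := Complex.norm_eq_one_of_pow_eq_one hζ (h.period_ne_zero hp)
  obtain ⟨h1, h2⟩ := h.smallSolution_spec hz
  refine (h.eq_smallSolution (by simpa [hζ1] using hz) (by simpa [hζ1] using h1) ?_).symm
  rw [h.seriesFun_mul_of_pow_eq_one hp hζ, mul_assoc, ← h2]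

/-- The points of the closed disc where the derivative of `u / φ(u)` vanishes at the small
solution are the points `ρ ζ` with `ζ ^ p = 1`. -/
theorem mul_derivative_eq_one_iff (h : SmoothInverseSchema φ τ ρ) {p : ℕ} (hp : HasPeriod φ p)
    {z : ℂ} (hz : ‖z‖ ≤ ρ) :
    z * seriesFun (PowerSeries.derivative ℝ φ) (smallSolution φ τ z) = 1 ↔
      ∃ ζ : ℂ, ζ ^ p = 1 ∧ z = (ρ : ℂ) * ζ := by
  have hp0 := h.period_ne_zero hp
  constructor
  · intro h1
    obtain ⟨hu, hzu⟩ := h.smallSolution_spec hz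
    set u := smallSolution φ τ z
    have hzρ : ‖z‖ = ρ := by
      refine le_antisymm hz (not_lt.1 fun hlt => ?_)
      have := h.norm_mul_derivative_lt_of_norm_lt hz (h.norm_lt_of_solution hlt hu hzu)
      rw [h1, norm_one] at this
      exact lt_irrefl _ this
    have huτ : ‖u‖ = τ := by
      refine le_antisymm hu (not_lt.1 fun hlt => ?_)
      have := h.norm_mul_derivative_lt_of_norm_lt hz hlt
      rw [h1, norm_one] at this
      exact lt_irrefl _ this
    have hnorm : ‖(seriesFun φ u : ℂ)‖ = seriesFun φ τ := by
      apply mul_left_cancel₀ h.rho_pos.ne'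
      rw [h.rho_mul, ← hzρ, ← norm_mul, ← hzu, huτ]
    have hτ0 : (τ : ℂ) ≠ 0 := by exact_mod_cast h.tau_pos.ne'
    have hpow {n : ℕ} (hn : PowerSeries.coeff n φ ≠ 0) : (u / τ) ^ n = 1 := by
      rw [div_pow, pow_eq_of_norm_seriesFun_eq h.nonneg h.coeff_zero_ne h.tau_pos.le h.tau_lt huτ
        hnorm hn, div_self (pow_ne_zero n hτ0)]
    -- The order of `u / τ` divides every exponent that occurs in `φ`, so it is itself a period.
    have hord : orderOf (u / τ) ∣ p := by
      obtain ⟨m, hm2, hm⟩ := h.exists_coeff_ne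
      refine hp.dvd_of_isPeriodicWith hp0 ?_ h.coeff_zero_ne
        (isPeriodicWith_of_dvd fun n hn => orderOf_dvd_of_pow_eq_one (hpow hn))
      intro h0
      have := orderOf_dvd_of_pow_eq_one (hpow hm)
      rw [h0, zero_dvd_iff] at this
      omega
    have hζ : (u / τ) ^ p = 1 := orderOf_dvd_iff_pow_eq_one.1 hord
    refine ⟨u / τ, hζ, ?_⟩
    have hval : (seriesFun φ u : ℂ) = seriesFun φ (τ : ℂ) := by
      rw [← h.seriesFun_mul_of_pow_eq_one hp hζ (τ : ℂ), div_mul_cancel₀ _ hτ0]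
    have hρ : (ρ : ℂ) * seriesFun φ (τ : ℂ) = τ := by
      rw [seriesFun_ofReal]; exact_mod_cast h.rho_mul
    have hne := h.seriesFun_ne_zero_of_solution hzu
    rw [hval] at hne hzu
    apply mul_right_cancel₀ hne
    rw [← hzu]
    field_simp
    linear_combination (-u) * hρ
  · rintro ⟨ζ, hζ, rfl⟩
    rw [mul_comm (ρ : ℂ) ζ, h.smallSolution_mul_of_pow_eq_one hp hζ
      (by simp [abs_of_pos h.rho_pos]), h.smallSolution_rho, mul_comm ζ (ρ : ℂ), mul_assoc,
      h.derivative_mul_of_pow_eq_one hp hζ, seriesFun_ofReal]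
    exact_mod_cast h.rho_mul_derivative

/-- Where `z φ'(u) = 1`, differentiating `g = z φ(g)` would give `φ(u) = 0`. -/
theorem isSingularityOn_of_mul_derivative_eq_one (h : SmoothInverseSchema φ τ ρ) {z₀ : ℂ}
    (hz : ‖z₀‖ ≤ ρ)
    (hd : z₀ * seriesFun (PowerSeries.derivative ℝ φ) (smallSolution φ τ z₀) = 1) :
    IsSingularityOn (smallSolution φ τ) (Metric.ball 0 ρ) z₀ := by
  have hcl : z₀ ∈ closure (Metric.ball (0 : ℂ) ρ) := by
    rw [closure_ball _ h.rho_pos.ne']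
    exact mem_closedBall_zero_iff.2 hz
  refine ⟨hcl, ?_⟩
  rintro ⟨g, hg, hgy⟩
  obtain ⟨hu, hzu⟩ := h.smallSolution_spec hz
  have hnotlt : ¬ ‖z₀‖ < ρ := fun hlt => by
    have := h.norm_mul_derivative_lt_of_norm_lt hz (h.norm_lt_of_solution hlt hu hzu)
    rw [hd, norm_one] at this
    exact lt_irrefl _ this
  have hne : (𝓝[Metric.ball 0 ρ] z₀).NeBot := mem_closure_iff_nhdsWithin_neBot.1 hcl
  have hg0 : g z₀ = smallSolution φ τ z₀ := by
    refine tendsto_nhds_unique (l := 𝓝[Metric.ball 0 ρ] z₀)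
      (hg.continuousAt.tendsto.mono_left nhdsWithin_le_nhds) ?_
    refine Tendsto.congr' hgy.symm ?_
    exact (h.continuousOn_smallSolution z₀ (mem_closedBall_zero_iff.2 hz)).tendsto.mono_left
      (nhdsWithin_mono _ Metric.ball_subset_closedBall)
  have hφan : AnalyticAt ℂ (seriesFun φ : ℂ → ℂ) (g z₀) := by
    rw [hg0]; exact analyticAt_seriesFun (h.norm_lt_convRadius hu)
  have hH : AnalyticAt ℂ (fun z => g z - z * seriesFun φ (g z)) z₀ :=
    hg.sub (analyticAt_id.mul (hφan.comp hg))
  -- The equation holds on the disc, hence on a full neighbourhood by the identity theorem.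
  have hev : ∀ᶠ z in 𝓝 z₀, g z - z * seriesFun φ (g z) = 0 := by
    refine hH.frequently_zero_iff_eventually_zero.1 ?_
    have hle : 𝓝[Metric.ball 0 ρ] z₀ ≤ 𝓝[≠] z₀ := nhdsWithin_mono _ fun w hw hw' => by
      rw [Set.mem_singleton_iff] at hw'
      exact hnotlt (by simpa [hw'] using hw)
    refine Frequently.filter_mono (Eventually.frequently ?_) hle
    filter_upwards [hgy, self_mem_nhdsWithin] with z h1 h2
    rw [h1, sub_eq_zero]
    exact (h.smallSolution_spec (mem_ball_zero_iff.1 h2).le).2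
  have hDφ : HasDerivAt (seriesFun φ : ℂ → ℂ)
      (seriesFun (PowerSeries.derivative ℝ φ) (g z₀)) (g z₀) :=
    hasDerivAt_seriesFun (by rw [hg0]; exact h.norm_lt_convRadius hu)
  have hDg := hg.differentiableAt.hasDerivAt
  have hD1 := hDg.sub ((hasDerivAt_id' z₀).mul (hDφ.comp z₀ hDg))
  have hD2 := (hasDerivAt_const z₀ (0 : ℂ)).congr_of_eventuallyEq hev
  have heq := hD1.unique hD2
  simp only [Function.comp_apply, hg0] at heq
  refine h.seriesFun_ne_zero_of_solution hzu ?_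
  linear_combination (-1 : ℂ) * heq - deriv g z₀ * hd

theorem isSingularityOn_smallSolution_iff (h : SmoothInverseSchema φ τ ρ) {p : ℕ}
    (hp : HasPeriod φ p) {z : ℂ} (hz : ‖z‖ ≤ ρ) :
    IsSingularityOn (smallSolution φ τ) (Metric.ball 0 ρ) z ↔
      ∃ ζ : ℂ, ζ ^ p = 1 ∧ z = (ρ : ℂ) * ζ := by
  rw [← h.mul_derivative_eq_one_iff hp hz]
  refine ⟨fun hs => ?_, h.isSingularityOn_of_mul_derivative_eq_one hz⟩
  by_contra hd
  obtain ⟨g, hg, heq⟩ := h.exists_analyticAt_eventuallyEq hz hd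
  exact hs.2 ⟨g, hg, heq.filter_mono (nhdsWithin_mono _ Metric.ball_subset_closedBall)⟩

end SmoothInverseSchema

/-! ### Taylor series and formal branches -/

/-- The formal Taylor series of `f` at `a`. -/
def taylorSeriesAt (f : ℂ → ℂ) (a : ℂ) : PowerSeries ℂ :=
  PowerSeries.mk fun n => iteratedDeriv n f a / (n.factorial : ℂ)

theorem coeff_taylorSeriesAt (f : ℂ → ℂ) (a : ℂ) (n : ℕ) :
    PowerSeries.coeff n (taylorSeriesAt f a) = iteratedDeriv n f a / (n.factorial : ℂ) :=
  PowerSeries.coeff_mk _ _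

theorem coeff_zero_taylorSeriesAt (f : ℂ → ℂ) (a : ℂ) :
    PowerSeries.coeff 0 (taylorSeriesAt f a) = f a := by
  simp [coeff_taylorSeriesAt]

theorem taylorSeriesAt_congr {f g : ℂ → ℂ} {a : ℂ} (hfg : f =ᶠ[𝓝 a] g) :
    taylorSeriesAt f a = taylorSeriesAt g a := by
  ext n
  rw [coeff_taylorSeriesAt, coeff_taylorSeriesAt, hfg.iteratedDeriv_eq n]

theorem taylorSeriesAt_const (c a : ℂ) : taylorSeriesAt (fun _ => c) a = PowerSeries.C c := by
  ext n
  rw [coeff_taylorSeriesAt, iteratedDeriv_const, PowerSeries.coeff_C]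
  split_ifs with hn <;> simp [hn]

theorem taylorSeriesAt_id : taylorSeriesAt (fun s => s) 0 = PowerSeries.X := by
  ext n
  rw [coeff_taylorSeriesAt, PowerSeries.coeff_X]
  rcases n with _ | _ | n
  · simp
  · simp [iteratedDeriv_one]
  · have : deriv (fun s : ℂ => s) = fun _ => 1 := by ext; simp
    rw [iteratedDeriv_succ', this, iteratedDeriv_const]
    simp

theorem taylorSeriesAt_add {f g : ℂ → ℂ} {a : ℂ} (hf : AnalyticAt ℂ f a)
    (hg : AnalyticAt ℂ g a) :
    taylorSeriesAt (fun s => f s + g s) a = taylorSeriesAt f a + taylorSeriesAt g a := by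
  ext n
  rw [map_add, coeff_taylorSeriesAt, coeff_taylorSeriesAt, coeff_taylorSeriesAt,
    ← add_div, iteratedDeriv_fun_add hf.contDiffAt hg.contDiffAt]

theorem taylorSeriesAt_sub {f g : ℂ → ℂ} {a : ℂ} (hf : AnalyticAt ℂ f a)
    (hg : AnalyticAt ℂ g a) :
    taylorSeriesAt (fun s => f s - g s) a = taylorSeriesAt f a - taylorSeriesAt g a := by
  rw [eq_sub_iff_add_eq, ← taylorSeriesAt_add (hf.fun_sub hg) hg]
  simp

theorem taylorSeriesAt_mul {f g : ℂ → ℂ} {a : ℂ} (hf : AnalyticAt ℂ f a)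
    (hg : AnalyticAt ℂ g a) :
    taylorSeriesAt (fun s => f s * g s) a = taylorSeriesAt f a * taylorSeriesAt g a := by
  ext n
  rw [PowerSeries.coeff_mul, coeff_taylorSeriesAt,
    iteratedDeriv_fun_mul hf.contDiffAt hg.contDiffAt,
    Finset.Nat.sum_antidiagonal_eq_sum_range_succ_mk, Finset.sum_div]
  refine Finset.sum_congr rfl fun i hi => ?_
  rw [coeff_taylorSeriesAt, coeff_taylorSeriesAt,
    Nat.cast_choose ℂ (Nat.lt_succ_iff.1 (Finset.mem_range.1 hi))]
  have h1 : (n.factorial : ℂ) ≠ 0 := by exact_mod_cast n.factorial_ne_zero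
  have h2 : (i.factorial : ℂ) ≠ 0 := by exact_mod_cast i.factorial_ne_zero
  have h3 : ((n - i).factorial : ℂ) ≠ 0 := by exact_mod_cast (n - i).factorial_ne_zero
  field_simp

theorem taylorSeriesAt_pow {f : ℂ → ℂ} {a : ℂ} (hf : AnalyticAt ℂ f a) (k : ℕ) :
    taylorSeriesAt (fun s => f s ^ k) a = taylorSeriesAt f a ^ k := by
  induction k with
  | zero => simpa using taylorSeriesAt_const 1 a
  | succ k ih =>
    simp_rw [pow_succ]
    rw [taylorSeriesAt_mul (hf.fun_pow k) hf, ih]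

theorem taylorSeriesAt_sum {N : ℕ} {f : ℕ → ℂ → ℂ} {a : ℂ} (hf : ∀ k, AnalyticAt ℂ (f k) a) :
    taylorSeriesAt (fun s => ∑ k ∈ Finset.range N, f k s) a =
      ∑ k ∈ Finset.range N, taylorSeriesAt (f k) a := by
  induction N with
  | zero => simpa using taylorSeriesAt_const 0 a
  | succ N ih =>
    simp_rw [Finset.sum_range_succ]
    rw [taylorSeriesAt_add (Finset.analyticAt_fun_sum _ fun k _ => hf k) (hf N), ih]

/-- Taylor's formula with an analytic remainder, obtained by iterating the divided difference
`dslope`. -/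
theorem AnalyticAt.exists_taylor_remainder {f : ℂ → ℂ} {a : ℂ} (hf : AnalyticAt ℂ f a) (N : ℕ) :
    ∃ B : ℂ → ℂ, AnalyticAt ℂ B a ∧ B a = iteratedDeriv N f a / (N.factorial : ℂ) ∧
      ∀ u, f u = ∑ k ∈ Finset.range N, iteratedDeriv k f a / (k.factorial : ℂ) * (u - a) ^ k +
        (u - a) ^ N * B u := by
  have hp := hf.hasFPowerSeriesAt
  have hB (N : ℕ) := hp.has_fpower_series_iterate_dslope_fslope N
  have hBa (N : ℕ) : (Function.swap dslope a)^[N] f a =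
      iteratedDeriv N f a / (N.factorial : ℂ) := by
    rw [← (hB N).coeff_zero 1, ← FormalMultilinearSeries.coeff,
      FormalMultilinearSeries.coeff_iterate_fslope, zero_add,
      FormalMultilinearSeries.coeff_ofScalars]
  refine ⟨(Function.swap dslope a)^[N] f, (hB N).analyticAt, hBa N, fun u => ?_⟩
  induction N with
  | zero => simp
  | succ N ih =>
    rw [Finset.sum_range_succ, ← hBa N, Function.iterate_succ_apply', ih]
    have := sub_smul_dslope ((Function.swap dslope a)^[N] f) a u
    rw [smul_eq_mul] at this
    change _ = _ + _ * dslope ((Function.swap dslope a)^[N] f) a u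
    linear_combination (-(u - a) ^ N) * this

/-- The coefficient identities of `g = r (1 - X²) ∑ₖ aₖ (g - t) ^ k`, over an arbitrary field.
Both real and complex coefficients are needed: the Taylor series of the analytic branch has complex
coefficients until they are shown to be real. -/
def IsFormalBranch {K : Type*} [Field K] (a : ℕ → K) (t r : K) (g : PowerSeries K) : Prop :=
  ∀ n : ℕ, PowerSeries.coeff n g =
    PowerSeries.coeff n (PowerSeries.C r * (1 - PowerSeries.X ^ 2) *
      ∑ k ∈ Finset.range (n + 1), PowerSeries.C (a k) * (g - PowerSeries.C t) ^ k)

section Formal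

open PowerSeries

variable {K L : Type*} [Field K] [Field L]

theorem IsFormalBranch.map {a : ℕ → K} {t r : K} {g : PowerSeries K}
    (hg : IsFormalBranch a t r g) (σ : K →+* L) :
    IsFormalBranch (fun k => σ (a k)) (σ t) (σ r) (PowerSeries.map σ g) := by
  intro n
  have := congrArg σ (hg n)
  rw [← PowerSeries.coeff_map, ← PowerSeries.coeff_map] at this
  simpa [map_sum] using this

theorem IsFormalBranch.of_map {a : ℕ → K} {t r : K} {g : PowerSeries K} (σ : K →+* L)
    (hg : IsFormalBranch (fun k => σ (a k)) (σ t) (σ r) (PowerSeries.map σ g)) :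
    IsFormalBranch a t r g := by
  intro n
  apply σ.injective
  rw [← PowerSeries.coeff_map, ← PowerSeries.coeff_map]
  simpa [map_sum] using hg n

/-- If `G` and `E` have zero constant term, then modulo `X²` only the terms `k ≤ 2` contribute to
the divided difference `∑ₖ aₖ (G ^ k - E ^ k) / (G - E)`. -/
theorem exists_divided_difference (a : ℕ → K) {G E : PowerSeries K} (hG : X ∣ G) (hE : X ∣ E)
    (m : ℕ) :
    ∃ T : PowerSeries K, ∑ k ∈ Finset.range (3 + m), C (a k) * G ^ k -
        ∑ k ∈ Finset.range (3 + m), C (a k) * E ^ k =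
      (G - E) * (C (a 1) + C (a 2) * (G + E) + X ^ 2 * T) := by
  have hdvd (k : ℕ) : (X : PowerSeries K) ^ 2 ∣
      ∑ i ∈ Finset.range (3 + k), G ^ i * E ^ (3 + k - 1 - i) := by
    refine Finset.dvd_sum fun i hi => ?_
    have hi' := Finset.mem_range.1 hi
    have h1 : (X : PowerSeries K) ^ (i + (3 + k - 1 - i)) ∣ G ^ i * E ^ (3 + k - 1 - i) := by
      rw [pow_add]
      exact mul_dvd_mul (pow_dvd_pow_of_dvd hG _) (pow_dvd_pow_of_dvd hE _)
    exact (pow_dvd_pow _ (by omega)).trans h1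
  choose T hT using hdvd
  refine ⟨∑ k ∈ Finset.range m, C (a (3 + k)) * T k, ?_⟩
  rw [Finset.sum_range_add, Finset.sum_range_add, Finset.mul_sum]
  have hsum : ∑ k ∈ Finset.range m, C (a (3 + k)) * G ^ (3 + k) -
      ∑ k ∈ Finset.range m, C (a (3 + k)) * E ^ (3 + k) =
      (G - E) * ∑ k ∈ Finset.range m, X ^ 2 * (C (a (3 + k)) * T k) := by
    rw [← Finset.sum_sub_distrib, Finset.mul_sum]
    refine Finset.sum_congr rfl fun k _ => ?_
    have h1 := (Commute.all G E).mul_geom_sum₂ (3 + k)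
    rw [hT k] at h1
    linear_combination (-C (a (3 + k))) * h1
  simp only [Finset.sum_range_succ, Finset.sum_range_zero]
  linear_combination hsum

/-- Comparing the coefficients of `X ^ (n + 1)` determines the `n`-th coefficient of the branch
for `n ≥ 2`: if `n` is the first index where two branches `g` and `e` differ, that coefficient of
the difference of the two equations is `-2 r a₂ g₁ (gₙ - eₙ)`. -/
theorem IsFormalBranch.unique [CharZero K] {a : ℕ → K} {t r : K} (hr1 : r * a 1 = 1)
    (hr2 : r * a 2 ≠ 0) {g e : PowerSeries K} (hg : IsFormalBranch a t r g)
    (he : IsFormalBranch a t r e) (hg0 : coeff 0 g = t) (he0 : coeff 0 e = t)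
    (h1 : coeff 1 e = coeff 1 g) (hg1 : coeff 1 g ≠ 0) : g = e := by
  ext n
  induction n using Nat.strong_induction_on with
  | _ n ih =>
  rcases n with _ | _ | n
  · rw [hg0, he0]
  · exact h1.symm
  set G := g - C t with hGdef
  set E := e - C t with hEdef
  have hG : X ∣ G := X_dvd_iff.2 (by
    rw [← coeff_zero_eq_constantCoeff_apply, hGdef, map_sub, hg0]; simp)
  have hE : X ∣ E := X_dvd_iff.2 (by
    rw [← coeff_zero_eq_constantCoeff_apply, hEdef, map_sub, he0]; simp)
  have hGE : G - E = g - e := by rw [hGdef, hEdef]; ring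
  obtain ⟨δ, hδ⟩ : X ^ (n + 2) ∣ G - E := by
    rw [X_pow_dvd_iff]
    intro m hm
    rw [hGE, map_sub, ih m hm, sub_self]
  obtain ⟨T, hT⟩ := exists_divided_difference a hG hE (n + 1)
  -- With `G - E = X ^ (n + 2) δ`, the two equations are compared at `X ^ (n + 3)`, where only the
  -- constant term of `δ` survives.
  have e1 := hg (n + 3)
  have e2 := he (n + 3)
  rw [show n + 3 + 1 = 3 + (n + 1) by ring] at e1 e2
  have e3 : coeff (n + 3) ((G - E) * (1 - C r * (1 - X ^ 2) *
      (C (a 1) + C (a 2) * (G + E) + X ^ 2 * T))) = 0 := by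
    have : (G - E) * (1 - C r * (1 - X ^ 2) * (C (a 1) + C (a 2) * (G + E) + X ^ 2 * T)) =
        (g - C r * (1 - X ^ 2) * ∑ k ∈ Finset.range (3 + (n + 1)), C (a k) * G ^ k) -
        (e - C r * (1 - X ^ 2) * ∑ k ∈ Finset.range (3 + (n + 1)), C (a k) * E ^ k) := by
      linear_combination hGE + C r * (1 - X ^ 2) * hT
    rw [this, map_sub, map_sub, map_sub, ← e1, ← e2]
    simp
  have hG1 : coeff 1 G = coeff 1 g := by simp [hGdef]
  have hE1 : coeff 1 E = coeff 1 g := by simp [hEdef, h1]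
  have hG0 : constantCoeff G = 0 := X_dvd_iff.1 hG
  have hE0 : constantCoeff E = 0 := X_dvd_iff.1 hE
  have hfac : 1 - C r * (1 - X ^ 2) * (C (a 1) + C (a 2) * (G + E) + X ^ 2 * T) =
      -C (r * a 2) * (G + E) +
        X ^ 2 * (C r * (C (a 1) + C (a 2) * (G + E) + X ^ 2 * T) - C r * T) := by
    have : (C r * C (a 1) : PowerSeries K) = 1 := by rw [← map_mul, hr1, map_one]
    rw [map_mul]
    linear_combination (-1 : PowerSeries K) * this
  obtain ⟨G', hG'⟩ := hG
  obtain ⟨E', hE'⟩ := hE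
  have hc : (G - E) * (1 - C r * (1 - X ^ 2) *
      (C (a 1) + C (a 2) * (G + E) + X ^ 2 * T)) = X ^ (n + 3) * (δ * (-C (r * a 2) * (G' + E') +
        X * (C r * (C (a 1) + C (a 2) * (G + E) + X ^ 2 * T) - C r * T))) := by
    rw [hfac, hδ]
    linear_combination (X ^ (n + 2) * δ * (-C (r * a 2))) * (hG' + hE')
  have hG'0 : constantCoeff G' = coeff 1 g := by
    rw [← hG1, hG', ← coeff_zero_eq_constantCoeff_apply, ← coeff_succ_X_mul]
  have hE'0 : constantCoeff E' = coeff 1 g := by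
    rw [← hE1, hE', ← coeff_zero_eq_constantCoeff_apply, ← coeff_succ_X_mul]
  rw [hc, coeff_X_pow_mul', if_pos le_rfl, Nat.sub_self, coeff_zero_eq_constantCoeff_apply] at e3
  simp only [map_mul, map_add, map_neg, constantCoeff_C, hG'0, hE'0, constantCoeff_X, zero_mul,
    add_zero] at e3
  have hδ0 : constantCoeff δ = 0 := by
    rcases mul_eq_zero.1 e3 with h | h
    · exact h
    · exfalso
      have h2 : (r * a 2) * (2 * coeff 1 g) = 0 := by linear_combination (-1 : K) * h
      exact mul_ne_zero hr2 (mul_ne_zero two_ne_zero hg1) h2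
  have hlast : coeff (n + 2) (g - e) = 0 := by
    rw [← hGE, hδ, coeff_X_pow_mul', if_pos le_rfl, Nat.sub_self,
      coeff_zero_eq_constantCoeff_apply, hδ0]
  rw [map_sub, sub_eq_zero] at hlast
  exact hlast

end Formal

/-- The Taylor series of an analytic solution `H` of `H = r (1 - s²) f(H)` is a formal branch. -/
theorem isFormalBranch_taylorSeriesAt {f H : ℂ → ℂ} {t r : ℂ} (hf : AnalyticAt ℂ f t)
    (hH : AnalyticAt ℂ H 0) (hH0 : H 0 = t) (heq : ∀ᶠ s in 𝓝 0, H s = r * (1 - s ^ 2) * f (H s)) :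
    IsFormalBranch (fun k => iteratedDeriv k f t / (k.factorial : ℂ)) t r
      (taylorSeriesAt H 0) := by
  intro n
  obtain ⟨B, hB, -, hfB⟩ := hf.exists_taylor_remainder (n + 1)
  have hBH : AnalyticAt ℂ (fun s => B (H s)) 0 := by
    refine AnalyticAt.comp (g := B) ?_ hH
    rwa [hH0]
  have hHt : AnalyticAt ℂ (fun s => H s - t) 0 := hH.sub analyticAt_const
  have hpre : AnalyticAt ℂ (fun s : ℂ => r * (1 - s ^ 2)) 0 := by fun_prop
  have hterm (k : ℕ) : AnalyticAt ℂ
      (fun s => iteratedDeriv k f t / (k.factorial : ℂ) * (H s - t) ^ k) 0 :=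
    analyticAt_const.mul (hHt.pow k)
  have hsum : AnalyticAt ℂ (fun s => ∑ k ∈ Finset.range (n + 1),
      iteratedDeriv k f t / (k.factorial : ℂ) * (H s - t) ^ k) 0 :=
    Finset.analyticAt_fun_sum _ fun k _ => hterm k
  have hrem : AnalyticAt ℂ (fun s => (H s - t) ^ (n + 1) * B (H s)) 0 := (hHt.fun_pow _).mul hBH
  have hT : taylorSeriesAt (fun s => H s - t) 0 = taylorSeriesAt H 0 - PowerSeries.C t := by
    rw [taylorSeriesAt_sub hH analyticAt_const, taylorSeriesAt_const]
  have hTpre : taylorSeriesAt (fun s : ℂ => r * (1 - s ^ 2)) 0 =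
      PowerSeries.C r * (1 - PowerSeries.X ^ 2) := by
    rw [taylorSeriesAt_mul analyticAt_const (by fun_prop), taylorSeriesAt_const,
      taylorSeriesAt_sub analyticAt_const (by fun_prop), taylorSeriesAt_const,
      taylorSeriesAt_pow (by fun_prop), taylorSeriesAt_id, map_one]
  have hmain : taylorSeriesAt H 0 = PowerSeries.C r * (1 - PowerSeries.X ^ 2) *
      (∑ k ∈ Finset.range (n + 1), PowerSeries.C (iteratedDeriv k f t / (k.factorial : ℂ)) *
        (taylorSeriesAt H 0 - PowerSeries.C t) ^ k +
        (taylorSeriesAt H 0 - PowerSeries.C t) ^ (n + 1) *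
          taylorSeriesAt (fun s => B (H s)) 0) := by
    have h1 : H =ᶠ[𝓝 0] fun s => r * (1 - s ^ 2) * (∑ k ∈ Finset.range (n + 1),
        iteratedDeriv k f t / (k.factorial : ℂ) * (H s - t) ^ k +
        (H s - t) ^ (n + 1) * B (H s)) := by
      filter_upwards [heq] with s hs
      rw [← hfB (H s)]
      exact hs
    conv_lhs => rw [taylorSeriesAt_congr h1]
    rw [taylorSeriesAt_mul hpre (hsum.fun_add hrem), taylorSeriesAt_add hsum hrem,
      taylorSeriesAt_sum hterm, hTpre, taylorSeriesAt_mul (hHt.fun_pow _) hBH,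
      taylorSeriesAt_pow hHt, hT]
    simp_rw [taylorSeriesAt_mul analyticAt_const (hHt.fun_pow _), taylorSeriesAt_const,
      taylorSeriesAt_pow hHt, hT]
  conv_lhs => rw [hmain]
  -- The remainder contains the factor `(H - t) ^ (n + 1)`, which is divisible by `X ^ (n + 1)`.
  rw [mul_add, map_add, add_eq_left]
  have hX : PowerSeries.X ∣ taylorSeriesAt H 0 - PowerSeries.C t := by
    rw [PowerSeries.X_dvd_iff, ← PowerSeries.coeff_zero_eq_constantCoeff_apply, map_sub,
      coeff_zero_taylorSeriesAt, hH0]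
    simp
  have hXn : PowerSeries.X ^ (n + 1) ∣ PowerSeries.C r * (1 - PowerSeries.X ^ 2) *
      ((taylorSeriesAt H 0 - PowerSeries.C t) ^ (n + 1) *
        taylorSeriesAt (fun s => B (H s)) 0) :=
    ((pow_dvd_pow_of_dvd hX _).mul_right _).mul_left _
  exact PowerSeries.X_pow_dvd_iff.1 hXn n (Nat.lt_succ_self n)

/-! ### The square-root branch at `ρ` -/

/-- The principal square root of `1 - z / ρ`. The exponent is the inverse of a cast natural number,
so that the lemmas on `n`-th roots apply. -/
def sqrtOneSub (ρ : ℝ) (z : ℂ) : ℂ :=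
  (1 - z / (ρ : ℂ)) ^ (((2 : ℕ) : ℂ)⁻¹)

theorem sqrtOneSub_sq (ρ : ℝ) (z : ℂ) : sqrtOneSub ρ z ^ 2 = 1 - z / (ρ : ℂ) :=
  Complex.cpow_nat_inv_pow _ two_ne_zero

theorem sqrtOneSub_pow (ρ : ℝ) (z : ℂ) (j : ℕ) :
    sqrtOneSub ρ z ^ j = (1 - z / (ρ : ℂ)) ^ ((j : ℂ) / 2) := by
  rw [sqrtOneSub, ← Complex.cpow_nat_mul, Nat.cast_two,
    div_eq_mul_inv (j : ℂ)]

theorem norm_sqrtOneSub_pow (ρ : ℝ) (z : ℂ) (N : ℕ) :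
    ‖sqrtOneSub ρ z‖ ^ N = ‖1 - z / (ρ : ℂ)‖ ^ ((N : ℝ) / 2) := by
  rw [sqrtOneSub, Complex.norm_cpow_inv_nat, ← Real.rpow_natCast, ← Real.rpow_mul (norm_nonneg _),
    Nat.cast_two, div_eq_inv_mul (N : ℝ)]

theorem tendsto_sqrtOneSub {ρ : ℝ} (hρ : 0 < ρ) :
    Tendsto (sqrtOneSub ρ) (𝓝 (ρ : ℂ)) (𝓝 0) := by
  have hρ' : (ρ : ℂ) ≠ 0 := by exact_mod_cast hρ.ne'
  have h1 : Tendsto (fun z : ℂ => ‖1 - z / (ρ : ℂ)‖ ^ ((1 : ℝ) / 2)) (𝓝 (ρ : ℂ)) (𝓝 0) := by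
    have hc : Continuous fun z : ℂ => ‖1 - z / (ρ : ℂ)‖ ^ ((1 : ℝ) / 2) :=
      (by fun_prop : Continuous fun z : ℂ => ‖1 - z / (ρ : ℂ)‖).rpow_const
        fun _ => Or.inr (by norm_num)
    have := hc.tendsto (ρ : ℂ)
    simpa [div_self hρ'] using this
  rw [tendsto_zero_iff_norm_tendsto_zero]
  refine h1.congr fun z => ?_
  simpa using (norm_sqrtOneSub_pow ρ z 1).symm

theorem analyticAt_sqrtOneSub {ρ : ℝ} {z : ℂ} (hz : z ∈ slitAt ρ) :
    AnalyticAt ℂ (sqrtOneSub ρ) z := by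
  have h1 : AnalyticAt ℂ (fun z : ℂ => 1 - z / (ρ : ℂ)) z := by
    simp_rw [div_eq_mul_inv]
    fun_prop
  exact h1.cpow analyticAt_const hz

theorem one_sub_div_re_pos {ρ : ℝ} {z : ℂ} (hz : ‖z‖ < ρ) : 0 < (1 - z / (ρ : ℂ)).re := by
  have hρ : 0 < ρ := (norm_nonneg z).trans_lt hz
  have h1 : (z / (ρ : ℂ)).re ≤ ‖z‖ / ρ := by
    refine (Complex.re_le_norm _).trans ?_
    rw [norm_div, Complex.norm_real, Real.norm_of_nonneg hρ.le]
  have h2 : ‖z‖ / ρ < 1 := (div_lt_one hρ).2 hz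
  rw [Complex.sub_re, Complex.one_re]
  linarith

/-- In the disc `1 - z / ρ` has positive real part, so its principal square root lies in the
sector `|arg s| < π / 4`; the inequality is a weak form of this. -/
theorem norm_sqrtOneSub_lt {ρ : ℝ} {z : ℂ} (hz : ‖z‖ < ρ) :
    ‖sqrtOneSub ρ z‖ < 2 * (sqrtOneSub ρ z).re := by
  set s := sqrtOneSub ρ z with hs
  have h1 : 0 < (s ^ 2).re := by
    rw [hs, sqrtOneSub_sq]
    exact one_sub_div_re_pos hz
  have h2 : 0 ≤ s.re := by
    have hne : 1 - z / (ρ : ℂ) ≠ 0 := fun h0 => by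
      have := one_sub_div_re_pos hz
      rw [h0] at this
      exact lt_irrefl _ this
    rw [hs, sqrtOneSub, Complex.cpow_def_of_ne_zero hne, Complex.exp_re]
    have him : (Complex.log (1 - z / (ρ : ℂ)) * ((2 : ℕ) : ℂ)⁻¹).im =
        Complex.arg (1 - z / (ρ : ℂ)) / 2 := by
      have : ((2 : ℕ) : ℂ)⁻¹ = ((1 / 2 : ℝ) : ℂ) := by push_cast; norm_num
      rw [this, mul_comm, Complex.im_ofReal_mul, Complex.log_im]
      ring
    rw [him]
    refine mul_nonneg (Real.exp_pos _).le (Real.cos_nonneg_of_neg_pi_div_two_le_of_le ?_ ?_)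
    · linarith [Complex.neg_pi_lt_arg (1 - z / (ρ : ℂ))]
    · linarith [Complex.arg_le_pi (1 - z / (ρ : ℂ))]
  have h3 : (s ^ 2).re = s.re ^ 2 - s.im ^ 2 := by
    rw [pow_two, Complex.mul_re]; ring
  have h4 : ‖s‖ ^ 2 = s.re ^ 2 + s.im ^ 2 := by
    rw [← Complex.normSq_eq_norm_sq, Complex.normSq_apply]; ring
  refine lt_of_pow_lt_pow_left₀ 2 (by linarith) ?_
  nlinarith [sq_nonneg s.im]

namespace SmoothInverseSchema

variable {φ : PowerSeries ℝ} {τ ρ : ℝ}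

theorem iteratedDeriv_two_pos (h : SmoothInverseSchema φ τ ρ) :
    0 < iteratedDeriv 2 (seriesFun φ : ℝ → ℝ) τ := by
  have hτ : ENNReal.ofReal ‖τ‖ < convRadius φ := by
    rw [Real.norm_of_nonneg h.tau_pos.le]; exact h.tau_lt
  rw [iteratedDeriv_seriesFun 2 hτ]
  obtain ⟨m, hm2, hm⟩ := h.exists_coeff_ne
  obtain ⟨k, rfl⟩ := Nat.exists_eq_add_of_le' hm2
  exact seriesFun_pos (m := k)
    (coeff_derivative_nonneg (coeff_derivative_nonneg h.nonneg))
    (coeff_derivative_ne_zero (coeff_derivative_ne_zero hm)) h.tau_pos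
    (h.tau_lt.trans_le (convRadius_le_iterate_derivative φ 2))

theorem iteratedDeriv_ofReal (h : SmoothInverseSchema φ τ ρ) (k : ℕ) :
    iteratedDeriv k (seriesFun φ : ℂ → ℂ) (τ : ℂ) =
      ((iteratedDeriv k (seriesFun φ : ℝ → ℝ) τ : ℝ) : ℂ) :=
  iteratedDeriv_seriesFun_ofReal k (by rw [abs_of_pos h.tau_pos]; exact h.tau_lt)

theorem analyticAt_tau (h : SmoothInverseSchema φ τ ρ) :
    AnalyticAt ℂ (seriesFun φ : ℂ → ℂ) (τ : ℂ) :=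
  analyticAt_seriesFun (h.norm_lt_convRadius (by simp [abs_of_pos h.tau_pos]))

theorem iteratedDeriv_one_tau (h : SmoothInverseSchema φ τ ρ) :
    iteratedDeriv 1 (seriesFun φ : ℝ → ℝ) τ = seriesFun (PowerSeries.derivative ℝ φ) τ :=
  iteratedDeriv_seriesFun 1 (by rw [Real.norm_of_nonneg h.tau_pos.le]; exact h.tau_lt)

/-- A uniformizing coordinate for `u / φ(u)` at its critical point `τ`. With
`φ(u) = φ(τ) + φ'(τ) (u - τ) + (u - τ)² A(u)` one has
`1 - u / (ρ φ(u)) = (u - τ)² A(u) / φ(u)`, and `A(τ) / φ(τ) > 0`, so the right side has an analytic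
square root `S` with a simple zero at `τ`. -/
theorem exists_uniformizer (h : SmoothInverseSchema φ τ ρ) :
    ∃ S : ℂ → ℂ, AnalyticAt ℂ S τ ∧ S τ = 0 ∧
      deriv S τ = -((Real.sqrt (iteratedDeriv 2 (seriesFun φ : ℝ → ℝ) τ /
        (2 * seriesFun φ τ)) : ℝ) : ℂ) ∧
      ∀ᶠ u : ℂ in 𝓝 (τ : ℂ), seriesFun φ u ≠ 0 ∧ u = ρ * (1 - S u ^ 2) * seriesFun φ u := by
  obtain ⟨A, hA, hAτ, hφA⟩ := h.analyticAt_tau.exists_taylor_remainder 2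
  set κ : ℝ := iteratedDeriv 2 (seriesFun φ : ℝ → ℝ) τ / (2 * seriesFun φ τ) with hκ
  have hφτ : (seriesFun φ (τ : ℂ) : ℂ) = ((seriesFun φ τ : ℝ) : ℂ) := seriesFun_ofReal φ τ
  have hφ0 : (seriesFun φ (τ : ℂ) : ℂ) ≠ 0 := by
    rw [hφτ]; exact_mod_cast h.seriesFun_tau_pos.ne'
  have hκpos : 0 < κ := div_pos h.iteratedDeriv_two_pos (mul_pos two_pos h.seriesFun_tau_pos)
  have hK : AnalyticAt ℂ (fun u : ℂ => A u / seriesFun φ u) τ := hA.div h.analyticAt_tau hφ0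
  have hKτ : A τ / seriesFun φ (τ : ℂ) = (κ : ℂ) := by
    rw [hAτ, h.iteratedDeriv_ofReal, hφτ, hκ]
    push_cast
    rw [div_div]
    norm_num
  let r : ℂ → ℂ := fun u => (A u / seriesFun φ u) ^ (((2 : ℕ) : ℂ)⁻¹)
  have hr : AnalyticAt ℂ r τ := hK.cpow analyticAt_const (by
    rw [hKτ]; exact Or.inl (by simpa using hκpos))
  have hrτ : r τ = ((Real.sqrt κ : ℝ) : ℂ) := by
    change (A τ / seriesFun φ (τ : ℂ)) ^ (((2 : ℕ) : ℂ)⁻¹) = _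
    rw [hKτ, Real.sqrt_eq_rpow, Complex.ofReal_cpow hκpos.le]
    norm_num
  refine ⟨fun u => (τ - u) * r u, (analyticAt_const.sub analyticAt_id).mul hr, by simp, ?_, ?_⟩
  · have hd := ((hasDerivAt_id' (τ : ℂ)).const_sub (τ : ℂ)).fun_mul
      hr.differentiableAt.hasDerivAt
    rw [hd.deriv, hrτ]
    simp
  · filter_upwards [h.analyticAt_tau.continuousAt.eventually_ne hφ0] with u hu
    refine ⟨hu, ?_⟩
    have hr2 : r u ^ 2 * seriesFun φ u = A u := by
      change ((A u / seriesFun φ u) ^ (((2 : ℕ) : ℂ)⁻¹)) ^ 2 * _ = _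
      rw [Complex.cpow_nat_inv_pow _ two_ne_zero, div_mul_cancel₀ _ hu]
    have hu2 := hφA u
    simp only [Finset.sum_range_succ, Finset.sum_range_zero, h.iteratedDeriv_ofReal,
      h.iteratedDeriv_one_tau, iteratedDeriv_zero] at hu2
    have e1 : (ρ : ℂ) * ((seriesFun φ τ : ℝ) : ℂ) = τ := by exact_mod_cast h.rho_mul
    have e2 : (ρ : ℂ) * ((seriesFun (PowerSeries.derivative ℝ φ) τ : ℝ) : ℂ) = 1 := by
      exact_mod_cast h.rho_mul_derivative
    simp only [Nat.factorial_zero, Nat.factorial_one, Nat.cast_one, div_one, pow_zero, mul_one,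
      pow_one, zero_add] at hu2
    linear_combination (-ρ : ℂ) * hu2 - e1 - (u - τ) * e2 + ρ * (u - τ) ^ 2 * hr2

/-- The analytic function `H` of the local coordinate `s = √(1 - z / ρ)` that parametrizes the
two branches of `u = z φ(u)` meeting at `z = ρ`. -/
theorem exists_puiseux_branch (h : SmoothInverseSchema φ τ ρ) :
    ∃ H : ℂ → ℂ, AnalyticAt ℂ H 0 ∧ H 0 = τ ∧
      HasDerivAt H (-((Real.sqrt (2 * seriesFun φ τ /
        iteratedDeriv 2 (seriesFun φ : ℝ → ℝ) τ) : ℝ) : ℂ)) 0 ∧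
      (∀ᶠ s in 𝓝 0, H s = ρ * (1 - s ^ 2) * seriesFun φ (H s)) ∧
      ∀ᶠ u : ℂ in 𝓝 (τ : ℂ), ∀ s, u = ρ * (1 - s ^ 2) * seriesFun φ u → u = H s ∨ u = H (-s) := by
  obtain ⟨S, hS, hS0, hS', hSeq⟩ := h.exists_uniformizer
  have hpos : 0 < iteratedDeriv 2 (seriesFun φ : ℝ → ℝ) τ / (2 * seriesFun φ τ) :=
    div_pos h.iteratedDeriv_two_pos (mul_pos two_pos h.seriesFun_tau_pos)
  have hne : deriv S τ ≠ 0 := by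
    rw [hS', neg_ne_zero]
    exact_mod_cast (Real.sqrt_pos.2 hpos).ne'
  obtain ⟨H, hH, hH0, hH', hSH, hHS⟩ := hS.exists_local_inverse hne
  rw [hS0] at hH hH0 hH' hSH
  refine ⟨H, hH, hH0, ?_, ?_, ?_⟩
  · convert hH' using 1
    rw [hS', inv_neg, ← Complex.ofReal_inv, ← Real.sqrt_inv, inv_div]
  · have ht : Tendsto H (𝓝 0) (𝓝 (τ : ℂ)) := by
      have := hH.continuousAt.tendsto
      rwa [hH0] at this
    filter_upwards [hSH, ht.eventually hSeq] with s h1 h2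
    have := h2.2
    rwa [h1] at this
  · filter_upwards [hHS, hSeq] with u h1 h2 s hs
    have hρ : (ρ : ℂ) ≠ 0 := by exact_mod_cast h.rho_pos.ne'
    have hsq : s ^ 2 = S u ^ 2 := by
      apply mul_left_cancel₀ (mul_ne_zero hρ h2.1)
      linear_combination hs - h2.2
    rcases sq_eq_sq_iff_eq_or_eq_neg.1 hsq with h3 | h3
    · exact Or.inl (by rw [h3, h1])
    · exact Or.inr (by rw [h3, neg_neg, h1])

/-- In the disc the small solution is the branch `H(s)` and not `H(-s)`: for `s` in the sector
`|arg s| < π / 4` the value `H(-s) = τ + d₁ s + o(s)` has real part larger than `τ`. -/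
theorem eventually_smallSolution_eq (h : SmoothInverseSchema φ τ ρ) {H : ℂ → ℂ} {b : ℝ}
    (hb : 0 < b) (hH0 : H 0 = τ) (hH' : HasDerivAt H (-(b : ℂ)) 0)
    (hHu : ∀ᶠ u : ℂ in 𝓝 (τ : ℂ), ∀ s, u = ρ * (1 - s ^ 2) * seriesFun φ u → u = H s ∨ u = H (-s)) :
    ∀ᶠ z in 𝓝 (ρ : ℂ), ‖z‖ < ρ → smallSolution φ τ z = H (sqrtOneSub ρ z) := by
  have hρmem : (ρ : ℂ) ∈ Metric.closedBall (0 : ℂ) ρ := by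
    simp [abs_of_pos h.rho_pos]
  have hy : Tendsto (smallSolution φ τ) (𝓝[Metric.ball 0 ρ] (ρ : ℂ)) (𝓝 (τ : ℂ)) := by
    have := (h.continuousOn_smallSolution _ hρmem).tendsto
    rw [h.smallSolution_rho] at this
    exact this.mono_left (nhdsWithin_mono _ Metric.ball_subset_closedBall)
  have hlin : ∀ᶠ s in 𝓝 (0 : ℂ), ‖H (-s) - τ - b * s‖ ≤ b / 2 * ‖s‖ := by
    have h1 := hH'.isLittleO.def (half_pos hb)
    have h2 : Tendsto (fun s : ℂ => -s) (𝓝 0) (𝓝 0) := by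
      simpa using (continuous_neg.tendsto (0 : ℂ))
    filter_upwards [h2.eventually h1] with s hs
    simpa [hH0, mul_comm] using hs
  have hs := ((tendsto_sqrtOneSub h.rho_pos).mono_left
    (nhdsWithin_le_nhds (s := Metric.ball 0 ρ))).eventually hlin
  have hmain : ∀ᶠ z in 𝓝[Metric.ball 0 ρ] (ρ : ℂ),
      smallSolution φ τ z = H (sqrtOneSub ρ z) := by
    filter_upwards [hy.eventually hHu, hs, self_mem_nhdsWithin] with z h1 h2 h3
    have hz := mem_ball_zero_iff.1 h3
    have hρ : (ρ : ℂ) ≠ 0 := by exact_mod_cast h.rho_pos.ne'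
    have heq : smallSolution φ τ z = ρ * (1 - sqrtOneSub ρ z ^ 2) *
        seriesFun φ (smallSolution φ τ z) := by
      rw [sqrtOneSub_sq]
      conv_lhs => rw [(h.smallSolution_spec hz.le).2]
      field_simp
      ring
    refine (h1 _ heq).resolve_right fun h4 => ?_
    -- `y = H(-s)` gives `re y ≥ τ + b (re s - ‖s‖ / 2) > τ`, against `‖y‖ < τ`.
    have h5 := h.norm_smallSolution_lt hz
    have h6 := norm_sqrtOneSub_lt hz
    set s := sqrtOneSub ρ z
    rw [← h4] at h2
    have h7 := (abs_le.1 ((Complex.abs_re_le_norm _).trans h2)).1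
    have h8 : (smallSolution φ τ z - τ - b * s).re = (smallSolution φ τ z).re - τ - b * s.re := by
      simp
    rw [h8] at h7
    have h9 := Complex.re_le_norm (smallSolution φ τ z)
    nlinarith
  rw [eventually_nhdsWithin_iff] at hmain
  filter_upwards [hmain] with z h1 h2 using h1 (mem_ball_zero_iff.2 h2)

end SmoothInverseSchema

/-! ### Gluing and the power series at `0` -/

/-- The small solution in the disc, continued by the branch `H(√(1 - z / ρ))` outside it. -/
def gluedSolution (φ : PowerSeries ℝ) (τ ρ : ℝ) (H : ℂ → ℂ) (z : ℂ) : ℂ :=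
  open Classical in if ‖z‖ < ρ then smallSolution φ τ z else H (sqrtOneSub ρ z)

namespace SmoothInverseSchema

variable {φ : PowerSeries ℝ} {τ ρ : ℝ}

theorem hasFPowerSeriesOnBall (h : SmoothInverseSchema φ τ ρ) :
    ∃ q : FormalMultilinearSeries ℂ ℂ ℂ,
      HasFPowerSeriesOnBall (smallSolution φ τ) q 0 (ENNReal.ofReal ρ) := by
  have hcoe : ((ρ.toNNReal : NNReal) : ℝ) = ρ := Real.coe_toNNReal ρ h.rho_pos.le
  refine ⟨_, DiffContOnCl.hasFPowerSeriesOnBall (R := ρ.toNNReal) ⟨?_, ?_⟩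
    (Real.toNNReal_pos.2 h.rho_pos)⟩
  · rw [hcoe]
    exact fun z hz => (h.analyticAt_smallSolution
      (mem_ball_zero_iff.1 hz)).differentiableAt.differentiableWithinAt
  · rw [hcoe, closure_ball _ h.rho_pos.ne']
    exact h.continuousOn_smallSolution

/-- The sum of a power series with radius larger than `ρ` would be analytic at the singularity
`ρ`. -/
theorem radius_eq (h : SmoothInverseSchema φ τ ρ) {p : ℕ} (hp : HasPeriod φ p)
    {q : FormalMultilinearSeries ℂ ℂ ℂ}
    (hq : HasFPowerSeriesOnBall (smallSolution φ τ) q 0 (ENNReal.ofReal ρ)) :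
    q.radius = ENNReal.ofReal ρ := by
  refine le_antisymm (not_lt.1 fun hlt => ?_) hq.r_le
  have hρ : ‖(ρ : ℂ)‖ = ρ := by simp [abs_of_pos h.rho_pos]
  have hsing := (h.isSingularityOn_smallSolution_iff hp (z := (ρ : ℂ)) hρ.le).2
    ⟨1, one_pow p, by simp⟩
  refine hsing.2 ⟨q.sum, ?_, ?_⟩
  · refine (q.hasFPowerSeriesOnBall (bot_le.trans_lt hlt)).analyticAt_of_mem ?_
    rw [Metric.mem_eball, edist_zero_right, ← ofReal_norm, hρ]
    exact hlt
  · filter_upwards [self_mem_nhdsWithin] with z hz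
    have := hq.sum (y := z) (by
      rw [Metric.mem_eball, edist_zero_right, ← ofReal_norm]
      exact (ENNReal.ofReal_lt_ofReal_iff h.rho_pos).2 (mem_ball_zero_iff.1 hz))
    rw [zero_add] at this
    exact this.symm

/-- The symmetry `y(ζ z) = ζ y(z)` for a primitive `p`-th root of unity `ζ`, read off on
coefficients. -/
theorem coeff_eq_zero (h : SmoothInverseSchema φ τ ρ) {p : ℕ} (hp : HasPeriod φ p)
    {q : FormalMultilinearSeries ℂ ℂ ℂ}
    (hq : HasFPowerSeriesOnBall (smallSolution φ τ) q 0 (ENNReal.ofReal ρ)) {n : ℕ}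
    (hn : ¬ n ≡ 1 [MOD p]) : q.coeff n = 0 := by
  have hp0 := h.period_ne_zero hp
  set ζ := Complex.exp (2 * Real.pi * Complex.I / p)
  have hζ : IsPrimitiveRoot ζ p := Complex.isPrimitiveRoot_exp p hp0
  have hζ1 : ‖ζ‖ = 1 := Complex.norm_eq_one_of_pow_eq_one hζ.pow_eq_one hp0
  have hzero : HasFPowerSeriesAt (fun _ : ℂ => (0 : ℂ))
      (FormalMultilinearSeries.ofScalars ℂ fun n => (ζ ^ n - ζ) * q.coeff n) 0 := by
    rw [hasFPowerSeriesAt_iff]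
    filter_upwards [Metric.ball_mem_nhds (0 : ℂ) h.rho_pos] with z hz
    have hz' := mem_ball_zero_iff.1 hz
    have hmem (w : ℂ) (hw : ‖w‖ < ρ) : w ∈ Metric.eball (0 : ℂ) (ENNReal.ofReal ρ) := by
      rw [Metric.mem_eball, edist_zero_right, ← ofReal_norm]
      exact (ENNReal.ofReal_lt_ofReal_iff h.rho_pos).2 hw
    have h1 := hq.hasSum (hmem (ζ * z) (by rw [norm_mul, hζ1, one_mul]; exact hz'))
    have h2 := (hq.hasSum (hmem z hz')).mul_left ζ
    have h3 := h1.sub h2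
    rw [zero_add, zero_add, h.smallSolution_mul_of_pow_eq_one hp hζ.pow_eq_one hz'.le,
      sub_self] at h3
    refine h3.congr_fun fun n => ?_
    simp only [FormalMultilinearSeries.apply_eq_pow_smul_coeff, smul_eq_mul,
      FormalMultilinearSeries.coeff_ofScalars, mul_pow]
    ring
  have hn0 := congrArg (fun s => s.coeff n) hzero.eq_zero
  simp only [FormalMultilinearSeries.coeff_ofScalars] at hn0
  have hn1 : (ζ ^ n - ζ) * q.coeff n = 0 := by
    rw [hn0]
    rfl
  refine (mul_eq_zero.1 hn1).resolve_left fun h1 => hn ?_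
  rcases n with _ | k
  · have hp1 : p ∣ 1 := hζ.dvd_of_pow_eq_one 1 (by linear_combination -h1)
    rw [Nat.dvd_one.1 hp1]
    exact Nat.modEq_one
  · have hk : p ∣ k := hζ.dvd_of_pow_eq_one k (by
      apply mul_left_cancel₀ (hζ.ne_zero hp0)
      linear_combination h1)
    simpa using (Nat.modEq_zero_iff_dvd.2 hk).add_right 1

/-- The Taylor coefficients of `H` are real: complex conjugation maps them to another formal branch
with the same first two coefficients. -/
theorem exists_real_coeff (h : SmoothInverseSchema φ τ ρ) {H : ℂ → ℂ} {b : ℝ} (hb : 0 < b)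
    (hH : AnalyticAt ℂ H 0) (hH0 : H 0 = τ) (hH' : HasDerivAt H (-(b : ℂ)) 0)
    (hHeq : ∀ᶠ s in 𝓝 0, H s = ρ * (1 - s ^ 2) * seriesFun φ (H s)) :
    ∃ d : ℕ → ℝ, d 0 = τ ∧ d 1 = b ∧ SatisfiesBranchEquation φ τ ρ d ∧
      (∀ e : ℕ → ℝ, e 0 = d 0 → e 1 = d 1 → SatisfiesBranchEquation φ τ ρ e → e = d) ∧
      ∀ n, iteratedDeriv n H 0 / (n.factorial : ℂ) = (-1) ^ n * (d n : ℂ) := by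
  set a : ℕ → ℝ := fun k => iteratedDeriv k (seriesFun φ : ℝ → ℝ) τ / (k.factorial : ℝ) with ha
  have ha1 : ρ * a 1 = 1 := by
    simp only [ha, h.iteratedDeriv_one_tau, Nat.factorial_one, Nat.cast_one, div_one]
    exact h.rho_mul_derivative
  have ha2 : ρ * a 2 ≠ 0 :=
    (mul_pos h.rho_pos (div_pos h.iteratedDeriv_two_pos (by positivity))).ne'
  set g := taylorSeriesAt H 0 with hgdef
  have hg : IsFormalBranch (fun k => ((a k : ℝ) : ℂ)) (τ : ℂ) (ρ : ℂ) g := by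
    have := isFormalBranch_taylorSeriesAt h.analyticAt_tau hH hH0 hHeq
    simp_rw [h.iteratedDeriv_ofReal] at this
    simpa [ha] using this
  have hg0 : PowerSeries.coeff 0 g = (τ : ℂ) := by rw [hgdef, coeff_zero_taylorSeriesAt, hH0]
  have hg1 : PowerSeries.coeff 1 g = -(b : ℂ) := by
    rw [hgdef, coeff_taylorSeriesAt, iteratedDeriv_one, hH'.deriv]
    simp
  have hconj : PowerSeries.map (starRingEnd ℂ) g = g := by
    refine IsFormalBranch.unique (a := fun k => ((a k : ℝ) : ℂ)) (t := (τ : ℂ)) (r := (ρ : ℂ))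
      (by exact_mod_cast ha1) (by exact_mod_cast ha2) ?_ hg ?_ hg0 ?_ ?_
    · simpa using hg.map (starRingEnd ℂ)
    · simp [PowerSeries.coeff_map, hg0, - PowerSeries.coeff_zero_eq_constantCoeff]
    · simp [PowerSeries.coeff_map, hg1]
    · simp [PowerSeries.coeff_map, hg1, hb.ne']
  have hre (n : ℕ) : (((PowerSeries.coeff n g).re : ℝ) : ℂ) = PowerSeries.coeff n g := by
    rw [← Complex.conj_eq_iff_re, ← PowerSeries.coeff_map, hconj]
  set d : ℕ → ℝ := fun n => (-1) ^ n * (PowerSeries.coeff n g).re with hd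
  have hsign (n : ℕ) (x : ℝ) : (-1) ^ n * ((-1) ^ n * x) = x := by
    rw [← mul_assoc, ← mul_pow]
    simp
  have hdg : PowerSeries.map Complex.ofRealHom (branchSeries d) = g := by
    ext n
    rw [PowerSeries.coeff_map, branchSeries, PowerSeries.coeff_mk, hd]
    simp only [hsign]
    exact hre n
  have hdb : IsFormalBranch a τ ρ (branchSeries d) :=
    IsFormalBranch.of_map Complex.ofRealHom (by rw [hdg]; exact hg)
  have hd0 : d 0 = τ := by
    simp only [hd, hg0]
    simp
  have hd1 : d 1 = b := by
    simp only [hd, hg1]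
    simp
  refine ⟨d, hd0, hd1, hdb, fun e he0 he1 he => ?_, fun n => ?_⟩
  · have hbr (e : ℕ → ℝ) (n : ℕ) : PowerSeries.coeff n (branchSeries e) = (-1) ^ n * e n :=
      PowerSeries.coeff_mk _ _
    have heq : branchSeries e = branchSeries d := by
      refine IsFormalBranch.unique ha1 ha2 he hdb ?_ ?_ ?_ ?_
      · rw [hbr, he0, hd0]; simp
      · rw [hbr, hd0]; simp
      · rw [hbr, hbr, he1]
      · rw [hbr, he1, hd1]; simpa using hb.ne'
    funext n
    have := congrArg (PowerSeries.coeff n) heq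
    rw [hbr, hbr] at this
    exact mul_left_cancel₀ (pow_ne_zero n (by norm_num)) this
  · rw [← coeff_taylorSeriesAt, ← hgdef, ← hre n, hd]
    push_cast
    rw [← mul_assoc, ← mul_pow]
    simp

theorem ncard_rho_mul_roots_of_unity (h : SmoothInverseSchema φ τ ρ) {p : ℕ} (hp : p ≠ 0) :
    {z : ℂ | ∃ ζ : ℂ, ζ ^ p = 1 ∧ z = (ρ : ℂ) * ζ}.ncard = p := by
  have hρ : (ρ : ℂ) ≠ 0 := by exact_mod_cast h.rho_pos.ne'
  have himage : {z : ℂ | ∃ ζ : ℂ, ζ ^ p = 1 ∧ z = (ρ : ℂ) * ζ} =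
      (fun ζ : ℂ => (ρ : ℂ) * ζ) '' (Polynomial.nthRootsFinset p (1 : ℂ) : Set ℂ) := by
    ext z
    simp only [Set.mem_ofPred_eq, Set.mem_image, Finset.mem_coe,
      Polynomial.mem_nthRootsFinset (Nat.pos_of_ne_zero hp), eq_comm (a := z)]
  rw [himage, Set.ncard_image_of_injective _ (mul_right_injective₀ hρ), Set.ncard_coe_finset,
    (Complex.isPrimitiveRoot_exp p hp).card_nthRootsFinset]

theorem gluedSolution_of_norm_lt {H : ℂ → ℂ} {z : ℂ} (hz : ‖z‖ < ρ) :
    gluedSolution φ τ ρ H z = smallSolution φ τ z :=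
  if_pos hz

theorem gluedSolution_eq {H : ℂ → ℂ} {z : ℂ}
    (hz : ‖z‖ < ρ → smallSolution φ τ z = H (sqrtOneSub ρ z)) :
    gluedSolution φ τ ρ H z = H (sqrtOneSub ρ z) := by
  unfold gluedSolution
  split_ifs with h1
  exacts [hz h1, rfl]

theorem exists_analyticOnNhd_gluedSolution (h : SmoothInverseSchema φ τ ρ) {H : ℂ → ℂ}
    (hH : AnalyticAt ℂ H 0)
    (hagree : ∀ᶠ z in 𝓝 (ρ : ℂ), ‖z‖ < ρ → smallSolution φ τ z = H (sqrtOneSub ρ z)) :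
    ∃ ε : ℝ, 0 < ε ∧ AnalyticOnNhd ℂ (gluedSolution φ τ ρ H)
      (Metric.ball 0 ρ ∪ (Metric.ball (ρ : ℂ) ε ∩ slitAt ρ)) := by
  obtain ⟨ε, hε, hball⟩ := Metric.eventually_nhds_iff_ball.1
    (hagree.and ((tendsto_sqrtOneSub h.rho_pos).eventually hH.eventually_analyticAt))
  refine ⟨ε, hε, ?_⟩
  rintro z (hz | ⟨hz, hzs⟩)
  · refine (h.analyticAt_smallSolution (mem_ball_zero_iff.1 hz)).congr ?_
    filter_upwards [Metric.isOpen_ball.mem_nhds hz] with w hw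
    exact (gluedSolution_of_norm_lt (mem_ball_zero_iff.1 hw)).symm
  · refine ((hball z hz).2.comp (analyticAt_sqrtOneSub hzs)).congr ?_
    filter_upwards [Metric.isOpen_ball.mem_nhds hz] with w hw
    exact (gluedSolution_eq (hball w hw).1).symm

theorem isBigO_gluedSolution (h : SmoothInverseSchema φ τ ρ) {H : ℂ → ℂ} {d : ℕ → ℝ}
    (hH : AnalyticAt ℂ H 0)
    (hagree : ∀ᶠ z in 𝓝 (ρ : ℂ), ‖z‖ < ρ → smallSolution φ τ z = H (sqrtOneSub ρ z))
    (hd : ∀ n, iteratedDeriv n H 0 / (n.factorial : ℂ) = (-1) ^ n * (d n : ℂ)) (N : ℕ) :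
    (fun z : ℂ => gluedSolution φ τ ρ H z - ∑ j ∈ Finset.range N,
      (-1 : ℂ) ^ j * (d j : ℂ) * (1 - z / (ρ : ℂ)) ^ ((j : ℂ) / 2))
      =O[𝓝 (ρ : ℂ)] (fun z : ℂ => ‖1 - z / (ρ : ℂ)‖ ^ ((N : ℝ) / 2)) := by
  obtain ⟨B, hB, -, hHB⟩ := hH.exists_taylor_remainder N
  have h1 : (fun z : ℂ => sqrtOneSub ρ z ^ N * B (sqrtOneSub ρ z)) =O[𝓝 (ρ : ℂ)]
      (fun z : ℂ => ‖sqrtOneSub ρ z‖ ^ N * (1 : ℝ)) := by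
    refine IsBigO.mul ?_ ?_
    · exact (isBigO_refl _ _).congr_right (fun _ => rfl) |>.norm_right.congr_right
        fun z => norm_pow _ _
    · exact (hB.continuousAt.tendsto.comp (tendsto_sqrtOneSub h.rho_pos)).isBigO_one ℝ
  refine h1.congr' ?_ ?_
  · filter_upwards [hagree] with z hz
    rw [gluedSolution_eq hz, hHB]
    simp only [sub_zero, hd, sqrtOneSub_pow]
    ring
  · filter_upwards with z
    rw [mul_one, norm_sqrtOneSub_pow]

end SmoothInverseSchema

theorem isSingularityOn_congr {f g : ℂ → ℂ} {D : Set ℂ} (hfg : Set.EqOn f g D) (w : ℂ) :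
    IsSingularityOn f D w ↔ IsSingularityOn g D w := by
  have h : f =ᶠ[𝓝[D] w] g := by
    filter_upwards [self_mem_nhdsWithin] with z hz using hfg hz
  unfold IsSingularityOn
  refine and_congr_right fun _ => not_congr (exists_congr fun k => and_congr_right fun _ => ?_)
  exact ⟨fun hk => hk.trans h, fun hk => hk.trans h.symm⟩

theorem exists_two_le_coeff_ne_zero {φ : PowerSeries ℝ}
    (hlin : ¬ ∃ a b : ℝ, φ = PowerSeries.C a + PowerSeries.C b * PowerSeries.X) :
    ∃ m, 2 ≤ m ∧ PowerSeries.coeff m φ ≠ 0 := by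
  by_contra! hcon
  refine hlin ⟨PowerSeries.coeff 0 φ, PowerSeries.coeff 1 φ, ?_⟩
  ext n
  rcases n with _ | _ | n
  · simp
  · simp [PowerSeries.coeff_C]
  · rw [hcon (n + 2) (by omega)]
    simp

end

theorem mainTheorem5
    (φ : PowerSeries ℝ) (R : ENNReal) (hR : R = convRadius φ) (hR0 : 0 < R)
    (h0 : PowerSeries.constantCoeff φ ≠ 0)
    (hnonneg : ∀ n : ℕ, 0 ≤ PowerSeries.coeff n φ)
    (hlin : ¬ ∃ a b : ℝ, φ = PowerSeries.C a + PowerSeries.C b * PowerSeries.X)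
    (τ : ℝ) (hτ0 : 0 < τ) (hτR : ENNReal.ofReal τ < R)
    (hτ : τ * deriv (seriesFun φ : ℝ → ℝ) τ = seriesFun φ τ)
    (p : ℕ) (hp : HasPeriod φ p)
    (ρ : ℝ) (hρ : ρ = τ / seriesFun φ τ) :
    ∃ (y : ℂ → ℂ) (q : FormalMultilinearSeries ℂ ℂ ℂ) (d : ℕ → ℝ) (ε : ℝ),
      -- `y` is the unique solution of `y = z φ(y)` analytic at `0` with `y(0) = 0`
      AnalyticAt ℂ y 0 ∧ y 0 = 0 ∧
      (∀ᶠ z in 𝓝 (0 : ℂ), y z = z * seriesFun φ (y z)) ∧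
      (∀ w : ℂ → ℂ, AnalyticAt ℂ w 0 → w 0 = 0 →
        (∀ᶠ z in 𝓝 (0 : ℂ), w z = z * seriesFun φ (w z)) → w =ᶠ[𝓝 0] y) ∧
      -- `q` is its power series at `0`; the radius of convergence is `ρ`, which is positive
      0 < ρ ∧
      HasFPowerSeriesOnBall y q 0 (ENNReal.ofReal ρ) ∧
      q.radius = ENNReal.ofReal ρ ∧
      (∀ z : ℂ, ‖z‖ < ρ → ENNReal.ofReal ‖y z‖ < R ∧ y z = z * seriesFun φ (y z)) ∧
      -- the singularities with `|z| ≤ ρ` are exactly the `p` points `ρ ζ` with `ζ ^ p = 1`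
      {z : ℂ | ‖z‖ ≤ ρ ∧ IsSingularityOn y (Metric.ball 0 ρ) z} =
        {z : ℂ | ∃ ζ : ℂ, ζ ^ p = 1 ∧ z = (ρ : ℂ) * ζ} ∧
      {z : ℂ | ‖z‖ ≤ ρ ∧ IsSingularityOn y (Metric.ball 0 ρ) z}.ncard = p ∧
      -- `y` is analytic on the disc and on a slit neighbourhood of `ρ`
      0 < ε ∧
      AnalyticOnNhd ℂ y (Metric.ball 0 ρ ∪ (Metric.ball (ρ : ℂ) ε ∩ slitAt ρ)) ∧
      -- the full asymptotic expansion for `z → ρ` there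
      (∀ N : ℕ,
        (fun z : ℂ => y z - ∑ j ∈ Finset.range N,
          (-1 : ℂ) ^ j * (d j : ℂ) * (1 - z / (ρ : ℂ)) ^ ((j : ℂ) / 2))
          =O[𝓝[slitAt ρ] (ρ : ℂ)]
        (fun z : ℂ => ‖1 - z / (ρ : ℂ)‖ ^ ((N : ℝ) / 2))) ∧
      d 0 = τ ∧
      d 1 = Real.sqrt (2 * seriesFun φ τ / iteratedDeriv 2 (seriesFun φ : ℝ → ℝ) τ) ∧
      -- the constants `d j` are computable: `d 0`, `d 1` and the equation determine them
      SatisfiesBranchEquation φ τ ρ d ∧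
      (∀ e : ℕ → ℝ, e 0 = d 0 → e 1 = d 1 → SatisfiesBranchEquation φ τ ρ e → e = d) ∧
      -- `[zⁿ] y = 0` unless `n ≡ 1` modulo `p`
      (∀ n : ℕ, ¬ n ≡ 1 [MOD p] → q.coeff n = 0) := by
  subst hR hρ
  have hnormτ : ENNReal.ofReal ‖τ‖ < convRadius φ := by rwa [Real.norm_of_nonneg hτ0.le]
  have h0' : PowerSeries.coeff 0 φ ≠ 0 := by
    rwa [PowerSeries.coeff_zero_eq_constantCoeff_apply]
  have hφτ : 0 < (seriesFun φ τ : ℝ) := seriesFun_pos hnonneg h0' hτ0 hτR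
  set ρ : ℝ := τ / seriesFun φ τ with hρ
  have h : SmoothInverseSchema φ τ ρ :=
    { nonneg := hnonneg
      coeff_zero_ne := h0'
      exists_coeff_ne := exists_two_le_coeff_ne_zero hlin
      tau_pos := hτ0
      tau_lt := hτR
      characteristic := by rwa [(hasDerivAt_seriesFun hnormτ).deriv] at hτ
      rho_mul := div_mul_cancel₀ _ hφτ.ne' }
  obtain ⟨H, hH, hH0, hH', hHeq, hHu⟩ := h.exists_puiseux_branch
  set b : ℝ := Real.sqrt (2 * seriesFun φ τ / iteratedDeriv 2 (seriesFun φ : ℝ → ℝ) τ)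
  have hb : 0 < b := Real.sqrt_pos.2 (div_pos (mul_pos two_pos hφτ) h.iteratedDeriv_two_pos)
  have hagree := h.eventually_smallSolution_eq hb hH0 hH' hHu
  obtain ⟨d, hd0, hd1, hdeq, hduniq, hdH⟩ := h.exists_real_coeff hb hH hH0 hH' hHeq
  obtain ⟨q, hq⟩ := h.hasFPowerSeriesOnBall
  obtain ⟨ε, hε, han⟩ := h.exists_analyticOnNhd_gluedSolution hH hagree
  have hEq : Set.EqOn (smallSolution φ τ) (gluedSolution φ τ ρ H) (Metric.ball 0 ρ) := fun z hz =>
    (SmoothInverseSchema.gluedSolution_of_norm_lt (mem_ball_zero_iff.1 hz)).symm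
  have hmem0 : (0 : ℂ) ∈ Metric.ball (0 : ℂ) ρ := Metric.mem_ball_self h.rho_pos
  have hsol (z : ℂ) (hz : ‖z‖ < ρ) : gluedSolution φ τ ρ H z =
      z * seriesFun φ (gluedSolution φ τ ρ H z) := by
    rw [SmoothInverseSchema.gluedSolution_of_norm_lt hz]
    exact (h.smallSolution_spec hz.le).2
  have hsing : {z : ℂ | ‖z‖ ≤ ρ ∧ IsSingularityOn (gluedSolution φ τ ρ H) (Metric.ball 0 ρ) z} =
      {z : ℂ | ∃ ζ : ℂ, ζ ^ p = 1 ∧ z = (ρ : ℂ) * ζ} := by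
    ext z
    simp only [Set.mem_ofPred_eq, ← isSingularityOn_congr hEq]
    refine ⟨fun hz => (h.isSingularityOn_smallSolution_iff hp hz.1).1 hz.2, fun hz => ?_⟩
    have hzρ : ‖z‖ ≤ ρ := by
      obtain ⟨ζ, hζ, rfl⟩ := hz
      rw [norm_mul, Complex.norm_eq_one_of_pow_eq_one hζ (h.period_ne_zero hp), mul_one,
        Complex.norm_real, Real.norm_of_nonneg h.rho_pos.le]
    exact ⟨hzρ, (h.isSingularityOn_smallSolution_iff hp hzρ).2 hz⟩
  refine ⟨gluedSolution φ τ ρ H, q, d, ε, han 0 (Or.inl hmem0), ?_, ?_, ?_, h.rho_pos, ?_,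
    h.radius_eq hp hq, fun z hz => ⟨?_, hsol z hz⟩, hsing, ?_, hε, han,
    fun N => (h.isBigO_gluedSolution hH hagree hdH N).mono nhdsWithin_le_nhds, hd0, hd1, hdeq,
    hduniq, fun n hn => h.coeff_eq_zero hp hq hn⟩
  · rw [← hEq hmem0, h.smallSolution_zero]
  · filter_upwards [Metric.ball_mem_nhds (0 : ℂ) h.rho_pos] with z hz
    exact hsol z (mem_ball_zero_iff.1 hz)
  · intro w hw hw0 hweq
    have hsmall : ∀ᶠ z in 𝓝 (0 : ℂ), ‖w z‖ < τ :=
      hw.continuousAt.norm.eventually_lt_const (by simpa [hw0] using hτ0)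
    filter_upwards [hweq, hsmall, Metric.ball_mem_nhds (0 : ℂ) h.rho_pos] with z h1 h2 h3
    rw [← hEq h3]
    exact h.eq_smallSolution (mem_ball_zero_iff.1 h3).le h2.le h1
  · refine hq.congr fun z hz => hEq ?_
    rw [Metric.mem_eball, edist_zero_right, ← ofReal_norm] at hz
    exact mem_ball_zero_iff.2 ((ENNReal.ofReal_lt_ofReal_iff h.rho_pos).1 hz)
  · rw [SmoothInverseSchema.gluedSolution_of_norm_lt hz]
    exact h.norm_lt_convRadius (h.norm_smallSolution_lt hz).le
  · rw [hsing]
    exact h.ncard_rho_mul_roots_of_unity (h.period_ne_zero hp)
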